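/- Let $I=[\rho,\xi]\subset\mathbb R$ be a compact interval with $\rho<\xi$ and length $|I|=\xi-\rho$. Let $0<c_1\le c_2$, $L\ge 0$ and $\varepsilon\in(0,1)$. Consider $C^2$ functions $f:I\to\mathbb R$ such that $c_1\le |f''(x)|\le c_2$ for all $x\in I$ and $f''$ is Lipschitz on $I$ with constant $L$. For real $Q\ge 1$ and $0<\delta\le 1/2$, put \[ \tilde N_f(Q,\delta)=\#\Bigl\{(a,b,q)\in\mathbb Z^3:\ 1\le q\le Q,\ \tfrac aq\in I,\ \gcd(a,b,q)=1,\ \Bigl|f\Bigl(\frac aq\Bigr)-\frac bq\Bigr|<\frac{\delta}{Q}\Bigr\}. \] (i) For every $\eta>0$ there is a constant $C$, depending only on $I,c_1,c_2,\varepsilon,\eta$ and $L$, such that for every such $f$, every $\tau$ with $0<\tau<\varepsilon/2$, and all real $Q\ge 1$ and $\delta$ with $Q^{\varepsilon-1}<\delta\le 1/2$, \[ \frac{2}{3\zeta(3)}-\eta-CQ^{-\tau}\ \le\ \frac{\tilde N_f(Q,\delta)}{|I|\,\delta\,Q^2}\ \le\ \frac{2}{3\zeta(3)}+\eta+CQ^{-\tau}.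 \] (ii) Consequently, for every such $f$, and every choice of $\delta=\delta(Q)$ with $Q^{\varepsilon-1}<\delta(Q)\le 1/2$ for all sufficiently large $Q$, \[ \tilde N_f(Q,\delta(Q))\sim\frac{2}{3\zeta(3)}\,|I|\,\delta(Q)\,Q^2\qquad(Q\to\infty). \] -/

import Mathlib

open Filter Asymptotics

open scoped NNReal

/-- The number `Ñ_f(Q, δ)` of integer triples `(a, b, q)` with `1 ≤ q ≤ Q`, `a / q ∈ [ρ, ξ]`,
`gcd(a, b, q) = 1` and `|f(a / q) - b / q| < δ / Q`. Only the values of `f` on `[ρ, ξ]` matter. -/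
noncomputable def countNear (ρ ξ : ℝ) (f : ℝ → ℝ) (Q δ : ℝ) : ℕ :=
  Set.ncard {p : ℤ × ℤ × ℤ |
    1 ≤ p.2.2 ∧ (p.2.2 : ℝ) ≤ Q ∧
    (p.1 : ℝ) / (p.2.2 : ℝ) ∈ Set.Icc ρ ξ ∧
    Int.gcd p.1 (Int.gcd p.2.1 p.2.2) = 1 ∧
    |f ((p.1 : ℝ) / (p.2.2 : ℝ)) - (p.2.1 : ℝ) / (p.2.2 : ℝ)| < δ / Q}

/-- `f` is `C²` on the compact interval `[ρ, ξ]` (one-sided derivatives at the end points), with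
`c₁ ≤ |f''| ≤ c₂` there, and `f''` is Lipschitz on `[ρ, ξ]` with constant `L`. -/
structure IsCurvedArc (ρ ξ c₁ c₂ : ℝ) (L : ℝ≥0) (f : ℝ → ℝ) : Prop where
  contDiffOn : ContDiffOn ℝ 2 f (Set.Icc ρ ξ)
  le_abs : ∀ x ∈ Set.Icc ρ ξ, c₁ ≤ |iteratedDerivWithin 2 f (Set.Icc ρ ξ) x|
  abs_le : ∀ x ∈ Set.Icc ρ ξ, |iteratedDerivWithin 2 f (Set.Icc ρ ξ) x| ≤ c₂
  lipschitz : LipschitzOnWith L (iteratedDerivWithin 2 f (Set.Icc ρ ξ)) (Set.Icc ρ ξ)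

/-- The real number `ζ(3)`. -/
noncomputable def zeta3 : ℝ := (riemannZeta 3).re

/-!
The count is a sum of local lattice point counts. Over an interval `[x, x + l]` the curve is within
`C l ^ 2` of its tangent at `x`, so if `l ^ 2` is a small multiple of `δ / Q`, the integer vectors
`(q, a, b)` with `a / q` in the interval and `b / q` near the curve are, up to a small relative
change of the height, the vectors of a unimodular lattice (`primalMap`, the integer vectors in the
frame of the curve at `x`) in a pyramid of size `r = l Q`. The lattice is scaled so that `r` is about
`(δ Q) ^ (1 / 2)`, which is at least a constant times `Q ^ (ε / 2)`.

The number of lattice points in such a pyramid is its volume up to an arbitrarily small proportion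
and an error `O(r ^ 2 * h)`, where `h` (`cuspHeight`) is the sum of the reciprocals of the shortest
vectors of the lattice and of its dual (`abs_ncard_pyramid_sub_le`). Indeed the number of points in
a translate of the pyramid averages to the volume; when the lattice has three short independent
vectors, every translate can be reduced to a small one, and otherwise the pigeonhole principle and a
count of the lattice points in a plane bound the volume by the error term. Möbius inversion over the
content of `(q, a, b)` turns this into a count of primitive vectors and produces the factor
`1 / ζ(3)` (`abs_ncard_primitive_pyramid_sub_le`).

It remains to see that `h` is small on average over the intervals. For this, intervals are divided
repeatedly into `M` equal parts. For a fixed vector, the mean of the reciprocal of its length grows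
by a factor `O(log M)` at each division, because its middle coordinate moves with a speed comparable
to its last one: this is where the curvature enters (`FrameCoords.sum_inv_frameSize_le`). For the
shortest vector the same holds up to a harmless term, since two short independent vectors of the
lattice have a short cross product in the dual lattice (`sum_inv_minNorm_le`). Hence the mean of `h`
over `N = M ^ n` intervals is `O((log M) ^ n)` up to a factor `O(1) ^ n`, that is `O(N ^ s)` with `s`
as small as desired once `M` is large (`CurvatureBounds.sum_cuspHeight_grid_le`), and the saving
`Q ^ (ε / 2)` in `r` absorbs it. All constants depend only on the interval and on the curvature
bounds, so the asymptotic formula is uniform in `f` (`exists_forall_abs_countNear_sub_le`). The first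
assertion then follows with a constant that is only needed for bounded `Q`.
-/

open scoped Matrix

/-! ### The arc and its tangents -/

/-- The two-point form of the curvature hypothesis used below: `g` plays the role of `f'`, its
increments are comparable to those of `x`, and the tangent lines approximate `f` to second order. -/
structure CurvatureBounds (ρ ξ c C : ℝ) (f g : ℝ → ℝ) : Prop where
  slope_lower : ∀ x ∈ Set.Icc ρ ξ, ∀ y ∈ Set.Icc ρ ξ, c * |y - x| ≤ |g y - g x|
  slope_upper : ∀ x ∈ Set.Icc ρ ξ, ∀ y ∈ Set.Icc ρ ξ, |g y - g x| ≤ C * |y - x|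
  tangent : ∀ x ∈ Set.Icc ρ ξ, ∀ y ∈ Set.Icc ρ ξ,
    |f y - f x - g x * (y - x)| ≤ C * (y - x) ^ 2

lemma exists_derivWithin_Icc_eq_slope {ρ ξ : ℝ} {h : ℝ → ℝ}
    (hh : DifferentiableOn ℝ h (Set.Icc ρ ξ)) {x y : ℝ} (hx : x ∈ Set.Icc ρ ξ)
    (hy : y ∈ Set.Icc ρ ξ) :
    ∃ z ∈ Set.Icc ρ ξ, |z - x| ≤ |y - x| ∧
      h y - h x = derivWithin h (Set.Icc ρ ξ) z * (y - x) := by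
  have key : ∀ u ∈ Set.Icc ρ ξ, ∀ v ∈ Set.Icc ρ ξ, u < v → ∃ z ∈ Set.Ioo u v,
      h v - h u = derivWithin h (Set.Icc ρ ξ) z * (v - u) := by
    intro u hu v hv huv
    have hsub : Set.Icc u v ⊆ Set.Icc ρ ξ := Set.Icc_subset_Icc hu.1 hv.2
    have hd : DifferentiableOn ℝ h (Set.Ioo u v) :=
      hh.mono (Set.Ioo_subset_Icc_self.trans hsub)
    obtain ⟨z, hz, hzs⟩ := exists_deriv_eq_slope h huv (hh.mono hsub).continuousOn hd
    refine ⟨z, hz, ?_⟩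
    have hnhds : Set.Icc ρ ξ ∈ nhds z :=
      Icc_mem_nhds (lt_of_le_of_lt hu.1 hz.1) (lt_of_lt_of_le hz.2 hv.2)
    rw [derivWithin_of_mem_nhds hnhds, hzs]
    field_simp [(sub_pos.2 huv).ne']
  rcases lt_trichotomy x y with hxy | hxy | hxy
  · obtain ⟨z, hz, e⟩ := key x hx y hy hxy
    refine ⟨z, ⟨hx.1.trans hz.1.le, hz.2.le.trans hy.2⟩, ?_, e⟩
    rw [abs_of_pos (sub_pos.2 hz.1), abs_of_pos (sub_pos.2 hxy)]
    linarith [hz.2]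
  · subst hxy
    exact ⟨x, hx, le_rfl, by simp⟩
  · obtain ⟨z, hz, e⟩ := key y hy x hx hxy
    refine ⟨z, ⟨hy.1.trans hz.1.le, hz.2.le.trans hx.2⟩, ?_, by linarith⟩
    rw [abs_of_neg (sub_neg.2 hz.2), abs_of_neg (sub_neg.2 hxy)]
    linarith [hz.1]

lemma IsCurvedArc.curvatureBounds {ρ ξ c₁ c₂ : ℝ} {L : ℝ≥0} {f : ℝ → ℝ} (hI : ρ < ξ)
    (hf : IsCurvedArc ρ ξ c₁ c₂ L f) {c C : ℝ} (hc : c ≤ c₁) (hC : c₂ ≤ C) :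
    CurvatureBounds ρ ξ c C f (derivWithin f (Set.Icc ρ ξ)) := by
  set g := derivWithin f (Set.Icc ρ ξ)
  have hu : UniqueDiffOn ℝ (Set.Icc ρ ξ) := uniqueDiffOn_Icc hI
  have hfd : DifferentiableOn ℝ f (Set.Icc ρ ξ) := hf.contDiffOn.differentiableOn (by norm_num)
  have hgd : DifferentiableOn ℝ g (Set.Icc ρ ξ) :=
    (hf.contDiffOn.derivWithin (m := 1) hu (by norm_num)).differentiableOn (by norm_num)
  have hit : ∀ x, iteratedDerivWithin 2 f (Set.Icc ρ ξ) x = derivWithin g (Set.Icc ρ ξ) x := by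
    intro x
    have h1 : iteratedDerivWithin 1 f (Set.Icc ρ ξ) = g := by
      funext y; rw [iteratedDerivWithin_one]
    rw [show (2 : ℕ) = 1 + 1 from rfl, iteratedDerivWithin_succ, h1]
  have hC0 : 0 ≤ C := by
    have := hf.abs_le ρ ⟨le_rfl, hI.le⟩
    exact ((abs_nonneg _).trans this).trans hC
  have hup : ∀ x ∈ Set.Icc ρ ξ, ∀ y ∈ Set.Icc ρ ξ, |g y - g x| ≤ C * |y - x| := by
    intro x hx y hy
    obtain ⟨z, hz, -, e⟩ := exists_derivWithin_Icc_eq_slope hgd hx hy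
    rw [e, abs_mul, ← hit]
    exact mul_le_mul_of_nonneg_right ((hf.abs_le z hz).trans hC) (abs_nonneg _)
  refine ⟨?_, hup, ?_⟩
  · intro x hx y hy
    obtain ⟨z, hz, -, e⟩ := exists_derivWithin_Icc_eq_slope hgd hx hy
    rw [e, abs_mul, ← hit]
    exact mul_le_mul_of_nonneg_right (hc.trans (hf.le_abs z hz)) (abs_nonneg _)
  · intro x hx y hy
    obtain ⟨z, hz, hzx, e⟩ := exists_derivWithin_Icc_eq_slope hfd hx hy
    rw [e, ← sub_mul, abs_mul, ← sq_abs (y - x), sq, ← mul_assoc]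
    exact mul_le_mul_of_nonneg_right ((hup x hx z hz).trans
      (mul_le_mul_of_nonneg_left hzx hC0)) (abs_nonneg _)

/-! ### Sums over the children of an interval -/

lemma sum_inv_max_one_le (M i₀ : ℕ) (hi : i₀ < M) :
    ∑ i ∈ Finset.range M, 1 / max 1 |(i : ℝ) - i₀| ≤ 3 + 2 * Real.log M := by
  have hH : ∀ n : ℕ, n ≤ M → ∑ i ∈ Finset.range n, 1 / ((i : ℝ) + 1) ≤ 1 + Real.log M := by
    intro n hn
    rcases Nat.eq_zero_or_pos n with rfl | hn0
    · have : 0 ≤ Real.log M := Real.log_natCast_nonneg M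
      simp; linarith
    have h1 := harmonic_le_one_add_log n
    have h2 : Real.log n ≤ Real.log M :=
      Real.log_le_log (by exact_mod_cast hn0) (by exact_mod_cast hn)
    have h3 : ((harmonic n : ℚ) : ℝ) = ∑ i ∈ Finset.range n, 1 / ((i : ℝ) + 1) := by
      simp [harmonic]
    linarith
  obtain ⟨k, rfl⟩ : ∃ k, M = i₀ + (1 + k) := ⟨M - i₀ - 1, by omega⟩
  rw [Finset.sum_range_add, Finset.sum_range_add, ← Finset.sum_range_reflect]
  have e1 : ∑ j ∈ Finset.range i₀, 1 / max 1 |((i₀ - 1 - j : ℕ) : ℝ) - i₀|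
      ≤ 1 + Real.log (i₀ + (1 + k) : ℕ) := by
    refine le_trans (Finset.sum_le_sum fun j hj => ?_) (hH i₀ (by omega))
    have hj' := Finset.mem_range.1 hj
    have : ((i₀ - 1 - j : ℕ) : ℝ) - i₀ = -((j : ℝ) + 1) := by
      rw [Nat.cast_sub (by omega), Nat.cast_sub (by omega)]; push_cast; ring
    rw [this, abs_neg, abs_of_pos (by positivity)]
    exact one_div_le_one_div_of_le (by positivity) (le_max_right _ _)
  have e2 : ∑ j ∈ Finset.range k, 1 / max 1 |((i₀ + (1 + j) : ℕ) : ℝ) - i₀|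
      ≤ 1 + Real.log (i₀ + (1 + k) : ℕ) := by
    refine le_trans (Finset.sum_le_sum fun j hj => ?_) (hH k (by omega))
    have : ((i₀ + (1 + j) : ℕ) : ℝ) - i₀ = (j : ℝ) + 1 := by push_cast; ring
    rw [this, abs_of_pos (by positivity)]
    exact one_div_le_one_div_of_le (by positivity) (le_max_right _ _)
  have e3 : ∑ j ∈ Finset.range 1, 1 / max 1 |((i₀ + j : ℕ) : ℝ) - i₀| = 1 := by simp
  linarith

/-- Reals `x i` that are pairwise `s`-separated like an arithmetic progression are, up to a factor
`2`, at distance `s * |i - i₀|` from `0`, where `x i₀` is the one nearest to `0`. -/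
lemma sum_inv_le_of_separated {M : ℕ} (hM : 0 < M) {s : ℝ} (hs : 0 < s) (x d : ℕ → ℝ)
    (hx : ∀ i < M, ∀ j < M, s * |(i : ℝ) - j| ≤ |x i - x j|)
    (hd : ∀ i < M, |x i| ≤ d i) (hds : ∀ i < M, s ≤ d i) :
    ∑ i ∈ Finset.range M, 1 / d i ≤ 2 / s * (3 + 2 * Real.log M) := by
  obtain ⟨i₀, hi₀, hmin⟩ := Finset.exists_min_image (Finset.range M) (fun i => |x i|)
    ⟨0, Finset.mem_range.2 hM⟩
  rw [Finset.mem_range] at hi₀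
  refine le_trans ?_ (mul_le_mul_of_nonneg_left (sum_inv_max_one_le M i₀ hi₀)
    (by positivity : 0 ≤ 2 / s))
  rw [Finset.mul_sum]
  refine Finset.sum_le_sum fun i hi => ?_
  have hi' := Finset.mem_range.1 hi
  have h1 := hx i hi' i₀ hi₀
  have h2 : |x i - x i₀| ≤ |x i| + |x i₀| := abs_sub _ _
  have h3 := hmin i hi
  have h4 : s / 2 * max 1 |(i : ℝ) - i₀| ≤ d i := by
    rcases max_cases (1 : ℝ) |(i : ℝ) - i₀| with ⟨e, -⟩ | ⟨e, -⟩ <;> rw [e]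
    · linarith [hds i hi']
    · linarith [hd i hi']
  have h5 : 0 < max 1 |(i : ℝ) - i₀| := lt_of_lt_of_le one_pos (le_max_left _ _)
  calc 1 / d i ≤ 1 / (s / 2 * max 1 |(i : ℝ) - i₀|) :=
        one_div_le_one_div_of_le (by positivity) h4
    _ = 2 / s * (1 / max 1 |(i : ℝ) - i₀|) := by field_simp

/-- The coordinates `(u₀, u₁, u₂)` of a fixed integer vector in the moving frame of the curve:
`u₂` is constant, `u₁` has derivative comparable to `u₂`, and `u₀` has derivative bounded by
`u₁`. Both the primal and the dual frame have this shape. -/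
structure FrameCoords (s : Set ℝ) (c C : ℝ) (u₀ u₁ : ℝ → ℝ) (u₂ : ℝ) : Prop where
  sep : ∀ y ∈ s, ∀ y' ∈ s, c * |y' - y| * |u₂| ≤ |u₁ y' - u₁ y|
  lip : ∀ y ∈ s, ∀ y' ∈ s, |u₁ y' - u₁ y| ≤ C * |y' - y| * |u₂|
  taylor : ∀ y ∈ s, ∀ y' ∈ s,
    |u₀ y' - u₀ y| ≤ C * (|y' - y| * |u₁ y| + |y' - y| ^ 2 * |u₂|)

/-- The size of frame coordinates at scale `l`. -/
noncomputable def frameSize (l a₀ a₁ a₂ : ℝ) : ℝ := max (|a₀| / l) (max |a₁| (l * |a₂|))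

lemma frameSize_le_iff {l a₀ a₁ a₂ r : ℝ} :
    frameSize l a₀ a₁ a₂ ≤ r ↔ |a₀| / l ≤ r ∧ |a₁| ≤ r ∧ l * |a₂| ≤ r := by
  simp [frameSize]

lemma FrameCoords.frameSize_le {s : Set ℝ} {c C : ℝ} {u₀ u₁ : ℝ → ℝ} {u₂ : ℝ}
    (h : FrameCoords s c C u₀ u₁ u₂) (hC : 1 ≤ C) {l : ℝ} (hl : 0 < l) {M : ℕ} (hM : 0 < M)
    {x y : ℝ} (hx : x ∈ s) (hy : y ∈ s) (hxy : |x - y| ≤ l) :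
    frameSize l (u₀ x) (u₁ x) u₂ ≤ 3 * C * M * frameSize (l / M) (u₀ y) (u₁ y) u₂ := by
  have hM' : (1 : ℝ) ≤ M := by exact_mod_cast hM
  set N := frameSize (l / M) (u₀ y) (u₁ y) u₂ with hN
  obtain ⟨h0, h1, h2⟩ := frameSize_le_iff.1 hN.ge
  have hN0 : 0 ≤ N := (abs_nonneg _).trans h1
  have h2' : l * |u₂| ≤ M * N := by
    have : l / M * |u₂| * M ≤ N * M := mul_le_mul_of_nonneg_right h2 (by positivity)
    have e : l / M * |u₂| * M = l * |u₂| := by field_simp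
    linarith
  have h0' : |u₀ y| ≤ l * N := by
    rw [div_le_iff₀ (by positivity)] at h0
    refine h0.trans ?_
    rw [mul_comm]
    exact mul_le_mul_of_nonneg_right (div_le_self hl.le hM') hN0
  have hMN : N ≤ M * N := le_mul_of_one_le_left hN0 hM'
  have hCMN : M * N ≤ C * (M * N) := le_mul_of_one_le_left (by positivity) hC
  have hlu : |x - y| * |u₂| ≤ M * N :=
    (mul_le_mul_of_nonneg_right hxy (abs_nonneg _)).trans h2'
  have a1 : |u₁ x| ≤ N + C * (M * N) := by
    have := h.lip y hy x hx
    have t := abs_sub_abs_le_abs_sub (u₁ x) (u₁ y)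
    have : C * |x - y| * |u₂| ≤ C * (M * N) := by
      rw [mul_assoc]; exact mul_le_mul_of_nonneg_left hlu (by positivity)
    linarith
  have a0 : |u₀ x| ≤ l * (N + C * (N + M * N)) := by
    have := h.taylor y hy x hx
    have t := abs_sub_abs_le_abs_sub (u₀ x) (u₀ y)
    have b1 : |x - y| * |u₁ y| ≤ l * N := mul_le_mul hxy h1 (abs_nonneg _) hl.le
    have b2 : |x - y| ^ 2 * |u₂| ≤ l * (M * N) := by
      rw [sq, mul_assoc]
      exact mul_le_mul hxy hlu (by positivity) hl.le
    have : C * (|x - y| * |u₁ y| + |x - y| ^ 2 * |u₂|) ≤ C * (l * N + l * (M * N)) :=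
      mul_le_mul_of_nonneg_left (by linarith) (by positivity)
    nlinarith
  have hCN : C * N ≤ C * (M * N) := mul_le_mul_of_nonneg_left hMN (by positivity)
  refine frameSize_le_iff.2 ⟨?_, by nlinarith, by nlinarith⟩
  rw [div_le_iff₀ hl]
  nlinarith

/-- Splitting an interval of length `l` into `M` equal parts, the average of the reciprocal size
of a fixed vector grows by at most a factor `O(log M)`. -/
lemma FrameCoords.sum_inv_frameSize_le {s : Set ℝ} {c C : ℝ} {u₀ u₁ : ℝ → ℝ} {u₂ : ℝ}
    (h : FrameCoords s c C u₀ u₁ u₂) (hc : 0 < c) (hc1 : c ≤ 1) (hC : 1 ≤ C) {l : ℝ} (hl : 0 < l)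
    {M : ℕ} (hM : 0 < M) {x : ℝ} (hx : ∀ i ≤ M, x + i * (l / M) ∈ s)
    (hN : 0 < frameSize l (u₀ x) (u₁ x) u₂) :
    ∑ i ∈ Finset.range M, 1 / frameSize (l / M) (u₀ (x + i * (l / M))) (u₁ (x + i * (l / M))) u₂
      ≤ 12 * C ^ 2 / c * (M * (3 + 2 * Real.log M)) / frameSize l (u₀ x) (u₁ x) u₂ := by
  have hM' : (1 : ℝ) ≤ M := by exact_mod_cast hM
  have hlog : 0 ≤ Real.log M := Real.log_natCast_nonneg M
  have hxs : x ∈ s := by simpa using hx 0 (Nat.zero_le _)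
  set N := frameSize l (u₀ x) (u₁ x) u₂ with hNdef
  set y : ℕ → ℝ := fun i => x + i * (l / M) with hy
  have hys : ∀ i < M, y i ∈ s := fun i hi => hx i hi.le
  have hyx : ∀ i < M, |y i - x| ≤ l := by
    intro i hi
    have : (i : ℝ) ≤ M := by exact_mod_cast hi.le
    have e : y i - x = i * (l / M) := by simp [hy]
    rw [e, abs_of_nonneg (by positivity)]
    calc (i : ℝ) * (l / M) ≤ M * (l / M) := by gcongr
      _ = l := by field_simp
  set σ : ℝ := 1 / (6 * C ^ 2) with hσ
  have hσ0 : 0 < σ := by positivity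
  have hσC : C ^ 2 * σ = 1 / 6 := by rw [hσ]; field_simp
  by_cases hu : l * |u₂| ≤ σ * N
  · -- `u₂` is negligible: `u₁` is almost constant, and if it is small then `u₀` stays large.
    have hbd : ∀ i < M, N / (6 * C) ≤ frameSize (l / M) (u₀ (y i)) (u₁ (y i)) u₂ := by
      intro i hi
      have hi2 : |y i - x| * |u₂| ≤ σ * N :=
        (mul_le_mul_of_nonneg_right (hyx i hi) (abs_nonneg _)).trans hu
      obtain ⟨g0, g1, -⟩ := frameSize_le_iff.1
        (le_refl (frameSize (l / M) (u₀ (y i)) (u₁ (y i)) u₂))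
      have hCσ : C * σ * N = N / (6 * C) := by rw [hσ]; field_simp
      by_cases hu1 : 2 * C * σ * N ≤ |u₁ x|
      · have t1 := h.lip x hxs (y i) (hys i hi)
        have t2 := abs_sub_abs_le_abs_sub (u₁ x) (u₁ (y i))
        rw [abs_sub_comm] at t2
        have : C * |y i - x| * |u₂| ≤ C * (σ * N) := by
          rw [mul_assoc]; exact mul_le_mul_of_nonneg_left hi2 (by positivity)
        linarith
      · push Not at hu1
        have hCσ1 : C * σ ≤ 1 / 6 := by nlinarith
        have hσ1 : σ ≤ 1 / 6 := by nlinarith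
        have hN0 : N = |u₀ x| / l := by
          rcases max_cases (|u₀ x| / l) (max |u₁ x| (l * |u₂|)) with ⟨e, -⟩ | ⟨e, -⟩
          · exact e
          · exfalso
            have e' : N = max |u₁ x| (l * |u₂|) := e
            have : max |u₁ x| (l * |u₂|) < N := by
              refine max_lt ?_ ?_ <;> nlinarith
            linarith
        have hN0' : |u₀ x| = l * N := by rw [hN0]; field_simp
        have t1 := h.taylor x hxs (y i) (hys i hi)
        have t2 := abs_sub_abs_le_abs_sub (u₀ x) (u₀ (y i))
        rw [abs_sub_comm] at t2
        have b1 : |y i - x| * |u₁ x| ≤ l * (2 * C * σ * N) :=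
          mul_le_mul (hyx i hi) hu1.le (abs_nonneg _) hl.le
        have b2 : |y i - x| ^ 2 * |u₂| ≤ l * (σ * N) := by
          rw [sq, mul_assoc]
          exact mul_le_mul (hyx i hi) hi2 (by positivity) hl.le
        have b3 : C * (|y i - x| * |u₁ x| + |y i - x| ^ 2 * |u₂|)
            ≤ C * (l * (2 * C * σ * N) + l * (σ * N)) :=
          mul_le_mul_of_nonneg_left (by linarith) (by positivity)
        have b4 : C * (l * (2 * C * σ * N) + l * (σ * N)) ≤ l * N / 2 := by
          have : C * (l * (2 * C * σ * N) + l * (σ * N))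
              = (2 * (C ^ 2 * σ) + C * σ) * (l * N) := by ring
          rw [this, hσC]
          have : 0 < l * N := by positivity
          nlinarith
        have b5 : l * N / 2 ≤ |u₀ (y i)| := by linarith
        refine le_trans ?_ g0
        rw [le_div_iff₀ (by positivity)]
        refine le_trans ?_ b5
        have : l / M ≤ l := div_le_self hl.le hM'
        have : N / (6 * C) ≤ N / 2 := div_le_div_of_nonneg_left hN.le (by norm_num) (by linarith)
        calc N / (6 * C) * (l / M) ≤ N / 2 * l := by gcongr
          _ = l * N / 2 := by ring
    calc ∑ i ∈ Finset.range M, 1 / frameSize (l / M) (u₀ (y i)) (u₁ (y i)) u₂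
        ≤ ∑ i ∈ Finset.range M, 6 * C / N := by
          refine Finset.sum_le_sum fun i hi => ?_
          have := one_div_le_one_div_of_le (by positivity) (hbd i (Finset.mem_range.1 hi))
          rwa [one_div_div] at this
      _ = 6 * C * M / N := by rw [Finset.sum_const, Finset.card_range, nsmul_eq_mul]; ring
      _ ≤ _ := by
          refine div_le_div_of_nonneg_right ?_ hN.le
          have h1 : 12 * C ≤ 12 * C ^ 2 / c := by
            rw [le_div_iff₀ hc]; nlinarith
          have h2 : (M : ℝ) ≤ M * (3 + 2 * Real.log M) := by nlinarith
          calc 6 * C * M ≤ 12 * C * M := by nlinarith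
            _ ≤ _ := by gcongr
  · push Not at hu
    have hu2 : 0 < l * |u₂| := lt_trans (by positivity) hu
    have hs : 0 < c * (l * |u₂|) / M := by positivity
    have := sum_inv_le_of_separated hM hs (fun i => u₁ (y i))
      (fun i => frameSize (l / M) (u₀ (y i)) (u₁ (y i)) u₂) ?_ ?_ ?_
    · refine this.trans ?_
      have : 2 / (c * (l * |u₂|) / M) ≤ 12 * C ^ 2 / c * M / N := by
        have : c * (σ * N) / M ≤ c * (l * |u₂|) / M := by gcongr
        calc 2 / (c * (l * |u₂|) / M) ≤ 2 / (c * (σ * N) / M) := by gcongr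
          _ = _ := by rw [hσ]; field_simp; ring
      calc _ ≤ 12 * C ^ 2 / c * M / N * (3 + 2 * Real.log M) := by gcongr
        _ = _ := by ring
    · intro i hi j hj
      refine le_trans (le_of_eq ?_) (h.sep (y j) (hys j hj) (y i) (hys i hi))
      have : y i - y j = (i - j) * (l / M) := by simp only [hy]; ring
      rw [this, abs_mul, abs_of_pos (by positivity : 0 < l / M)]
      ring
    · intro i hi
      exact (frameSize_le_iff.1 le_rfl).2.1
    · intro i hi
      refine le_trans ?_ (frameSize_le_iff.1 le_rfl).2.2
      have : 0 ≤ l / M * |u₂| := by positivity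
      calc c * (l * |u₂|) / M = c * (l / M * |u₂|) := by ring
        _ ≤ 1 * (l / M * |u₂|) := by gcongr
        _ = _ := one_mul _

/-! ### Lattices and their shortest vectors -/

/-- An integer vector seen as a real vector. -/
def castVec (z : Fin 3 → ℤ) : Fin 3 → ℝ := fun i => z i

@[simp] lemma castVec_apply (z : Fin 3 → ℤ) (i : Fin 3) : castVec z i = z i := rfl

lemma castVec_sub (z w : Fin 3 → ℤ) : castVec (z - w) = castVec z - castVec w := by
  funext i; simp

lemma castVec_add (z w : Fin 3 → ℤ) : castVec (z + w) = castVec z + castVec w := by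
  funext i; simp

lemma castVec_smul (d : ℤ) (z : Fin 3 → ℤ) : castVec (d • z) = (d : ℝ) • castVec z := by
  funext i; simp

lemma castVec_eq_zero {z : Fin 3 → ℤ} : castVec z = 0 ↔ z = 0 := by
  simp [funext_iff]

lemma castVec_cross (z w : Fin 3 → ℤ) : castVec (z ⨯₃ w) = castVec z ⨯₃ castVec w := by
  funext i
  fin_cases i <;> simp [cross_apply]

lemma norm_fin_three_le_iff {v : Fin 3 → ℝ} {r : ℝ} :
    ‖v‖ ≤ r ↔ |v 0| ≤ r ∧ |v 1| ≤ r ∧ |v 2| ≤ r := by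
  constructor
  · intro h
    have := fun i => (norm_le_pi_norm v i).trans h
    exact ⟨this 0, this 1, this 2⟩
  · rintro ⟨h0, h1, h2⟩
    rw [pi_norm_le_iff_of_nonneg ((abs_nonneg _).trans h0)]
    intro i
    fin_cases i
    exacts [h0, h1, h2]

lemma norm_cross_le (v w : Fin 3 → ℝ) : ‖v ⨯₃ w‖ ≤ 2 * (‖v‖ * ‖w‖) := by
  have key : ∀ i j k m : Fin 3, |v i * w j - v k * w m| ≤ 2 * (‖v‖ * ‖w‖) := by
    intro i j k m
    have h : ∀ i j : Fin 3, |v i * w j| ≤ ‖v‖ * ‖w‖ := by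
      intro i j
      rw [abs_mul]
      exact mul_le_mul (norm_le_pi_norm v i) (norm_le_pi_norm w j) (abs_nonneg _) (norm_nonneg _)
    linarith [abs_sub (v i * w j) (v k * w m), h i j, h k m]
  rw [norm_fin_three_le_iff, cross_apply]
  exact ⟨key _ _ _ _, key _ _ _ _, key _ _ _ _⟩

lemma eq_smul_of_cross_eq_zero {v w : Fin 3 → ℝ} (hw : w ≠ 0) (h : v ⨯₃ w = 0) :
    ∃ t : ℝ, v = t • w := by
  by_contra hcon
  refine (crossProduct_ne_zero_iff_linearIndependent.2 ?_) h
  rw [LinearIndependent.pair_symm_iff, LinearIndependent.pair_iff' hw]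
  exact fun t ht => hcon ⟨t, ht.symm⟩

lemma finite_norm_map_castVec_le {T : (Fin 3 → ℝ) →ₗ[ℝ] (Fin 3 → ℝ)} (hT : Function.Injective T)
    (r : ℝ) : {z : Fin 3 → ℤ | ‖T (castVec z)‖ ≤ r}.Finite := by
  obtain ⟨K, -, hK⟩ := T.exists_antilipschitzWith (LinearMap.ker_eq_bot.2 hT)
  refine (Set.Finite.pi' fun _ : Fin 3 => Set.finite_Icc (-⌈K * r⌉) ⌈K * r⌉).subset ?_
  intro z hz i
  have h1 : ‖castVec z‖ ≤ K * r := by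
    have := hK.le_mul_dist (castVec z) 0
    rw [map_zero, dist_zero_right, dist_zero_right] at this
    exact this.trans (mul_le_mul_of_nonneg_left hz K.2)
  have h2 : |(z i : ℝ)| ≤ ⌈K * r⌉ := ((norm_le_pi_norm _ i).trans h1).trans (Int.le_ceil _)
  have h3 : |z i| ≤ ⌈K * r⌉ := by exact_mod_cast h2
  exact abs_le.1 h3

/-- The sup-norm length of the shortest nonzero vector of the lattice `T ℤ³`. -/
noncomputable def minNorm (T : (Fin 3 → ℝ) →ₗ[ℝ] (Fin 3 → ℝ)) : ℝ :=
  sInf {r | ∃ z : Fin 3 → ℤ, z ≠ 0 ∧ ‖T (castVec z)‖ = r}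

lemma minNorm_le (T : (Fin 3 → ℝ) →ₗ[ℝ] (Fin 3 → ℝ)) {z : Fin 3 → ℤ} (hz : z ≠ 0) :
    minNorm T ≤ ‖T (castVec z)‖ := by
  refine csInf_le ⟨0, ?_⟩ ⟨z, hz, rfl⟩
  rintro _ ⟨w, -, rfl⟩
  exact norm_nonneg _

lemma le_minNorm {T : (Fin 3 → ℝ) →ₗ[ℝ] (Fin 3 → ℝ)} {r : ℝ}
    (h : ∀ z : Fin 3 → ℤ, z ≠ 0 → r ≤ ‖T (castVec z)‖) : r ≤ minNorm T := by
  refine le_csInf ⟨_, fun _ => 1, ?_, rfl⟩ ?_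
  · intro h; simpa using congrFun h 0
  · rintro _ ⟨w, hw, rfl⟩
    exact h w hw

lemma exists_norm_eq_minNorm {T : (Fin 3 → ℝ) →ₗ[ℝ] (Fin 3 → ℝ)} (hT : Function.Injective T) :
    ∃ z : Fin 3 → ℤ, z ≠ 0 ∧ ‖T (castVec z)‖ = minNorm T := by
  have hone : (fun _ => 1 : Fin 3 → ℤ) ≠ 0 := by
    intro h; simpa using congrFun h 0
  set e : Fin 3 → ℤ := fun _ => 1
  obtain ⟨z, ⟨hzr, hz0⟩, hz⟩ := Set.exists_min_image
    ({z : Fin 3 → ℤ | ‖T (castVec z)‖ ≤ ‖T (castVec e)‖} ∩ {z | z ≠ 0})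
    (fun z => ‖T (castVec z)‖) ((finite_norm_map_castVec_le hT _).inter_of_left _)
    ⟨e, (le_refl _ : ‖T (castVec e)‖ ≤ ‖T (castVec e)‖), hone⟩
  refine ⟨z, hz0, le_antisymm (le_minNorm fun w hw => ?_) (minNorm_le T hz0)⟩
  by_cases hwe : ‖T (castVec w)‖ ≤ ‖T (castVec e)‖
  · exact hz w ⟨hwe, hw⟩
  · exact le_trans hzr (not_le.1 hwe).le

lemma minNorm_pos {T : (Fin 3 → ℝ) →ₗ[ℝ] (Fin 3 → ℝ)} (hT : Function.Injective T) :
    0 < minNorm T := by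
  obtain ⟨z, hz, e⟩ := exists_norm_eq_minNorm hT
  rw [← e, norm_pos_iff, Ne, map_eq_zero_iff T hT, castVec_eq_zero]
  exact hz

/-- If the lattices `A' i` refine `A` in such a way that the reciprocal length of every single
vector is well controlled on average, then so is the reciprocal of the shortest vector. The extra
term accounts for a shortest vector of `A' i` that is not parallel to the shortest vector of `A`:
the cross product of the two is then a short vector of the dual lattice `B`. -/
lemma sum_inv_minNorm_le {A B : (Fin 3 → ℝ) →ₗ[ℝ] (Fin 3 → ℝ)} (hA : Function.Injective A)
    (hB : Function.Injective B) (hAB : ∀ v w, B (v ⨯₃ w) = A v ⨯₃ A w) {M : ℕ}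
    {A' : ℕ → (Fin 3 → ℝ) →ₗ[ℝ] (Fin 3 → ℝ)} (hA' : ∀ i, Function.Injective (A' i))
    {D S : ℝ} (hD : 0 < D) (hDA : ∀ i < M, ∀ z, ‖A (castVec z)‖ ≤ D * ‖A' i (castVec z)‖)
    (hS : ∀ z : Fin 3 → ℤ, z ≠ 0 →
      ∑ i ∈ Finset.range M, 1 / ‖A' i (castVec z)‖ ≤ S / ‖A (castVec z)‖) :
    ∑ i ∈ Finset.range M, 1 / minNorm (A' i)
      ≤ S / minNorm A + M * (1 / minNorm B + D ^ 2 / 2) := by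
  obtain ⟨z₁, hz₁, e₁⟩ := exists_norm_eq_minNorm hA
  have hposB := minNorm_pos hB
  have key : ∀ i ∈ Finset.range M, 1 / minNorm (A' i)
      ≤ 1 / ‖A' i (castVec z₁)‖ + (1 / minNorm B + D ^ 2 / 2) := by
    intro i hi
    obtain ⟨z, hz, e⟩ := exists_norm_eq_minNorm (hA' i)
    have hn : 0 < ‖A' i (castVec z)‖ := e ▸ minNorm_pos (hA' i)
    rw [← e]
    have hzz₁ : ‖A (castVec z₁)‖ ≤ ‖A (castVec z)‖ := e₁ ▸ minNorm_le A hz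
    have hrest : 0 ≤ 1 / minNorm B + D ^ 2 / 2 := by positivity
    by_cases hpar : castVec z ⨯₃ castVec z₁ = 0
    · obtain ⟨t, ht⟩ := eq_smul_of_cross_eq_zero (mt castVec_eq_zero.1 hz₁) hpar
      have hpos₁ : 0 < ‖A (castVec z₁)‖ := e₁ ▸ minNorm_pos hA
      have ht1 : 1 ≤ |t| := by
        rw [ht, map_smul, norm_smul, Real.norm_eq_abs] at hzz₁
        exact le_of_mul_le_mul_right (by linarith) hpos₁
      have hle : ‖A' i (castVec z₁)‖ ≤ ‖A' i (castVec z)‖ := by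
        rw [ht, map_smul, norm_smul, Real.norm_eq_abs]
        exact le_mul_of_one_le_left (norm_nonneg _) ht1
      have hp : 0 < ‖A' i (castVec z₁)‖ :=
        (minNorm_pos (hA' i)).trans_le (minNorm_le _ hz₁)
      linarith [one_div_le_one_div_of_le hp hle]
    · have hw : z ⨯₃ z₁ ≠ 0 := by
        rw [← castVec_cross] at hpar
        exact mt castVec_eq_zero.2 hpar
      have h1 := minNorm_le B hw
      rw [castVec_cross, hAB] at h1
      have h2 := norm_cross_le (A (castVec z)) (A (castVec z₁))
      have h3 := hDA i (Finset.mem_range.1 hi) z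
      set n := ‖A' i (castVec z)‖
      have h4 : minNorm B ≤ 2 * D ^ 2 * n ^ 2 := by
        have : ‖A (castVec z)‖ * ‖A (castVec z₁)‖ ≤ (D * n) * (D * n) :=
          mul_le_mul h3 (hzz₁.trans h3) (norm_nonneg _) (by positivity)
        nlinarith
      have h5 : 1 / (2 * D ^ 2 * n ^ 2) ≤ 1 / minNorm B := one_div_le_one_div_of_le hposB h4
      have h6 : 1 / n ≤ 1 / (2 * D ^ 2 * n ^ 2) + D ^ 2 / 2 := by
        have e : 1 / (2 * D ^ 2 * n ^ 2) + D ^ 2 / 2 - 1 / n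
            = (D ^ 2 * n - 1) ^ 2 / (2 * D ^ 2 * n ^ 2) := by field_simp; ring
        have : 0 ≤ (D ^ 2 * n - 1) ^ 2 / (2 * D ^ 2 * n ^ 2) := by positivity
        linarith
      have : 0 ≤ 1 / ‖A' i (castVec z₁)‖ := by positivity
      linarith
  refine (Finset.sum_le_sum key).trans ?_
  rw [Finset.sum_add_distrib, Finset.sum_const, Finset.card_range, nsmul_eq_mul, ← e₁]
  linarith [hS z₁ hz₁]

/-! ### The moving lattice of the curve -/

/-- The integer vector `(q, a, b)` in the frame of the curve at `x` and scale `l`: the coordinates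
are `l * q`, `a - q x` and, divided by `l`, the height of `(a, b)` over `q` times the tangent. -/
noncomputable def primalMap (f g : ℝ → ℝ) (l x : ℝ) : (Fin 3 → ℝ) →ₗ[ℝ] (Fin 3 → ℝ) :=
  Matrix.toLin' !![l, 0, 0; -x, 1, 0; (g x * x - f x) / l, -g x / l, 1 / l]

/-- The dual frame: the integer vector `(j₀, c, j)`, read as the function
`y ↦ j₀ + c y + j f y`, has as coordinates its value at `x` divided by `l`, its derivative at `x`,
and `l * j`. -/
noncomputable def dualMap (f g : ℝ → ℝ) (l x : ℝ) : (Fin 3 → ℝ) →ₗ[ℝ] (Fin 3 → ℝ) :=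
  Matrix.toLin' !![1 / l, x / l, f x / l; 0, 1, g x; 0, 0, l]

lemma primalMap_apply (f g : ℝ → ℝ) (l x : ℝ) (v : Fin 3 → ℝ) :
    primalMap f g l x v =
      ![l * v 0, v 1 - v 0 * x, (v 2 - v 0 * f x - g x * (v 1 - v 0 * x)) / l] := by
  funext i
  fin_cases i <;> simp [primalMap, Matrix.mulVec, dotProduct, Fin.sum_univ_three] <;> ring

lemma dualMap_apply (f g : ℝ → ℝ) (l x : ℝ) (v : Fin 3 → ℝ) :
    dualMap f g l x v =
      ![(v 0 + v 1 * x + v 2 * f x) / l, v 1 + v 2 * g x, l * v 2] := by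
  funext i
  fin_cases i <;> simp [dualMap, Matrix.mulVec, dotProduct, Fin.sum_univ_three] <;> ring

lemma det_primalMap (f g : ℝ → ℝ) {l : ℝ} (hl : l ≠ 0) (x : ℝ) :
    LinearMap.det (primalMap f g l x) = 1 := by
  simp [primalMap, LinearMap.det_toLin', Matrix.det_fin_three, hl]

lemma det_dualMap (f g : ℝ → ℝ) {l : ℝ} (hl : l ≠ 0) (x : ℝ) :
    LinearMap.det (dualMap f g l x) = 1 := by
  simp [dualMap, LinearMap.det_toLin', Matrix.det_fin_three, hl]

lemma injective_of_det_eq_one {T : (Fin 3 → ℝ) →ₗ[ℝ] (Fin 3 → ℝ)} (h : LinearMap.det T = 1) :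
    Function.Injective T := by
  have : IsUnit (LinearMap.det T) := by rw [h]; exact isUnit_one
  exact ((Module.End.isUnit_iff _).1 ((LinearMap.isUnit_iff_isUnit_det _).2 this)).1

lemma dualMap_cross (f g : ℝ → ℝ) {l : ℝ} (hl : l ≠ 0) (x : ℝ) (v w : Fin 3 → ℝ) :
    dualMap f g l x (v ⨯₃ w) = primalMap f g l x v ⨯₃ primalMap f g l x w := by
  rw [primalMap_apply, primalMap_apply, dualMap_apply, cross_apply, cross_apply]
  funext i
  fin_cases i <;> simp <;> field_simp <;> ring

lemma primalMap_cross (f g : ℝ → ℝ) {l : ℝ} (hl : l ≠ 0) (x : ℝ) (v w : Fin 3 → ℝ) :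
    primalMap f g l x (v ⨯₃ w) = dualMap f g l x v ⨯₃ dualMap f g l x w := by
  rw [primalMap_apply, dualMap_apply, dualMap_apply, cross_apply, cross_apply]
  funext i
  fin_cases i <;> simp <;> field_simp <;> ring

lemma norm_fin_three (v : Fin 3 → ℝ) : ‖v‖ = max |v 0| (max |v 1| |v 2|) := by
  refine eq_of_forall_ge_iff fun r => ?_
  rw [norm_fin_three_le_iff]; simp

lemma norm_primalMap (f g : ℝ → ℝ) {l : ℝ} (hl : 0 < l) (x : ℝ) (v : Fin 3 → ℝ) :
    ‖primalMap f g l x v‖ =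
      frameSize l (v 2 - v 0 * f x - g x * (v 1 - v 0 * x)) (v 1 - v 0 * x) (v 0) := by
  refine eq_of_forall_ge_iff fun r => ?_
  rw [norm_fin_three_le_iff, frameSize_le_iff, primalMap_apply]
  simp only [Matrix.cons_val_zero, Matrix.cons_val_one, Matrix.cons_val, abs_div, abs_mul,
    abs_of_pos hl]
  tauto

lemma norm_dualMap (f g : ℝ → ℝ) {l : ℝ} (hl : 0 < l) (x : ℝ) (v : Fin 3 → ℝ) :
    ‖dualMap f g l x v‖ =
      frameSize l (v 0 + v 1 * x + v 2 * f x) (v 1 + v 2 * g x) (v 2) := by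
  refine eq_of_forall_ge_iff fun r => ?_
  rw [norm_fin_three_le_iff, frameSize_le_iff, dualMap_apply]
  simp only [Matrix.cons_val_zero, Matrix.cons_val_one, Matrix.cons_val, abs_div, abs_mul,
    abs_of_pos hl]

section
variable {ρ ξ c C : ℝ} {f g : ℝ → ℝ}

lemma CurvatureBounds.frameCoords_primal (h : CurvatureBounds ρ ξ c C f g) (hc1 : c ≤ 1)
    (hC : 1 ≤ C) (v : Fin 3 → ℝ) :
    FrameCoords (Set.Icc ρ ξ) c C (fun x => v 2 - v 0 * f x - g x * (v 1 - v 0 * x))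
      (fun x => v 1 - v 0 * x) (v 0) := by
  have e : ∀ y y', |v 1 - v 0 * y' - (v 1 - v 0 * y)| = |y' - y| * |v 0| := by
    intro y y'
    rw [← abs_mul, ← abs_neg]; congr 1; ring
  refine ⟨fun y _ y' _ => ?_, fun y _ y' _ => ?_, fun y hy y' hy' => ?_⟩
  · rw [e, mul_assoc]
    exact mul_le_of_le_one_left (by positivity) hc1
  · rw [e, mul_assoc]
    exact le_mul_of_one_le_left (by positivity) hC
  · have h1 := h.tangent y' hy' y hy
    have h2 := h.slope_upper y hy y' hy'
    have e1 : v 2 - v 0 * f y' - g y' * (v 1 - v 0 * y')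
          - (v 2 - v 0 * f y - g y * (v 1 - v 0 * y))
        = v 0 * (f y - f y' - g y' * (y - y')) - (g y' - g y) * (v 1 - v 0 * y) := by ring
    rw [e1]
    refine (abs_sub _ _).trans ?_
    rw [abs_mul, abs_mul, sq_abs]
    have h3 : |v 0| * |f y - f y' - g y' * (y - y')| ≤ |v 0| * (C * (y - y') ^ 2) :=
      mul_le_mul_of_nonneg_left h1 (abs_nonneg _)
    have h4 := mul_le_mul_of_nonneg_right h2 (abs_nonneg (v 1 - v 0 * y))
    nlinarith

lemma CurvatureBounds.frameCoords_dual (h : CurvatureBounds ρ ξ c C f g)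
    (hC : 1 ≤ C) (v : Fin 3 → ℝ) :
    FrameCoords (Set.Icc ρ ξ) c C (fun x => v 0 + v 1 * x + v 2 * f x)
      (fun x => v 1 + v 2 * g x) (v 2) := by
  have e : ∀ y y', |v 1 + v 2 * g y' - (v 1 + v 2 * g y)| = |g y' - g y| * |v 2| := by
    intro y y'
    rw [← abs_mul]; congr 1; ring
  refine ⟨fun y hy y' hy' => ?_, fun y hy y' hy' => ?_, fun y hy y' hy' => ?_⟩
  · rw [e]
    exact mul_le_mul_of_nonneg_right (h.slope_lower y hy y' hy') (abs_nonneg _)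
  · rw [e]
    exact mul_le_mul_of_nonneg_right (h.slope_upper y hy y' hy') (abs_nonneg _)
  · have h1 := h.tangent y hy y' hy'
    have e1 : v 0 + v 1 * y' + v 2 * f y' - (v 0 + v 1 * y + v 2 * f y)
        = (y' - y) * (v 1 + v 2 * g y) + v 2 * (f y' - f y - g y * (y' - y)) := by ring
    rw [e1]
    refine (abs_add_le _ _).trans ?_
    rw [abs_mul, abs_mul, sq_abs]
    have h3 := mul_le_mul_of_nonneg_left h1 (abs_nonneg (v 2))
    have h4 : |y' - y| * |v 1 + v 2 * g y| ≤ C * (|y' - y| * |v 1 + v 2 * g y|) :=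
      le_mul_of_one_le_left (by positivity) hC
    nlinarith

/-- The sum of the reciprocals of the shortest vectors of the primal and of the dual lattice:
it controls the error in counting lattice points. -/
noncomputable def cuspHeight (f g : ℝ → ℝ) (l x : ℝ) : ℝ :=
  1 / minNorm (primalMap f g l x) + 1 / minNorm (dualMap f g l x)

lemma CurvatureBounds.sum_cuspHeight_children_le (h : CurvatureBounds ρ ξ c C f g) (hc : 0 < c)
    (hc1 : c ≤ 1) (hC : 1 ≤ C) {l : ℝ} (hl : 0 < l) {M : ℕ} (hM : 0 < M) {x : ℝ}
    (hx : ∀ i ≤ M, x + i * (l / M) ∈ Set.Icc ρ ξ) :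
    ∑ i ∈ Finset.range M, cuspHeight f g (l / M) (x + i * (l / M))
      ≤ M * ((12 * C ^ 2 / c * (3 + 2 * Real.log M) + 1) * cuspHeight f g l x
          + (3 * C * M) ^ 2) := by
  have hM' : (1 : ℝ) ≤ M := by exact_mod_cast hM
  have hlM : 0 < l / M := by positivity
  have hxs : x ∈ Set.Icc ρ ξ := by simpa using hx 0 (Nat.zero_le _)
  have hP := fun x => injective_of_det_eq_one (det_primalMap f g hl.ne' x)
  have hD := fun x => injective_of_det_eq_one (det_dualMap f g hl.ne' x)
  have hP' := fun x => injective_of_det_eq_one (det_primalMap f g hlM.ne' x)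
  have hD' := fun x => injective_of_det_eq_one (det_dualMap f g hlM.ne' x)
  have hxy : ∀ i < M, |x - (x + i * (l / M))| ≤ l := by
    intro i hi
    have : (i : ℝ) ≤ M := by exact_mod_cast hi.le
    rw [sub_add_cancel_left, abs_neg, abs_of_nonneg (by positivity)]
    calc (i : ℝ) * (l / M) ≤ M * (l / M) := by gcongr
      _ = l := by field_simp
  have hp : ∀ {T : (Fin 3 → ℝ) →ₗ[ℝ] (Fin 3 → ℝ)}, Function.Injective T →
      ∀ z : Fin 3 → ℤ, z ≠ 0 → 0 < ‖T (castVec z)‖ := by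
    intro T hT z hz
    exact (minNorm_pos hT).trans_le (minNorm_le T hz)
  have s1 := sum_inv_minNorm_le (hP x) (hD x) (dualMap_cross f g hl.ne' x) (M := M)
    (A' := fun i => primalMap f g (l / M) (x + i * (l / M))) (fun i => hP' _)
    (D := 3 * C * M) (S := 12 * C ^ 2 / c * (M * (3 + 2 * Real.log M))) (by positivity)
    (fun i hi z => by
      rw [norm_primalMap f g hl, norm_primalMap f g hlM]
      exact (h.frameCoords_primal hc1 hC _).frameSize_le hC hl hM hxs (hx i hi.le) (hxy i hi))
    (fun z hz => by
      have h0 := hp (hP x) z hz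
      rw [norm_primalMap f g hl] at h0 ⊢
      simp only [norm_primalMap f g hlM]
      exact (h.frameCoords_primal hc1 hC _).sum_inv_frameSize_le hc hc1 hC hl hM hx h0)
  have s2 := sum_inv_minNorm_le (hD x) (hP x) (primalMap_cross f g hl.ne' x) (M := M)
    (A' := fun i => dualMap f g (l / M) (x + i * (l / M))) (fun i => hD' _)
    (D := 3 * C * M) (S := 12 * C ^ 2 / c * (M * (3 + 2 * Real.log M))) (by positivity)
    (fun i hi z => by
      rw [norm_dualMap f g hl, norm_dualMap f g hlM]
      exact (h.frameCoords_dual hC _).frameSize_le hC hl hM hxs (hx i hi.le) (hxy i hi))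
    (fun z hz => by
      have h0 := hp (hD x) z hz
      rw [norm_dualMap f g hl] at h0 ⊢
      simp only [norm_dualMap f g hlM]
      exact (h.frameCoords_dual hC _).sum_inv_frameSize_le hc hc1 hC hl hM hx h0)
  simp only [cuspHeight]
  rw [Finset.sum_add_distrib]
  refine (add_le_add s1 s2).trans (le_of_eq ?_)
  ring

/-- A bound that does not involve `f` and `g`: a nonzero integer vector has a nonzero coordinate, and
the frame is triangular. -/
lemma cuspHeight_le (f g : ℝ → ℝ) {l : ℝ} (hl : 0 < l) (x : ℝ) :
    cuspHeight f g l x ≤ 2 * (1 + l + 1 / l) := by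
  have hm : ∀ n : ℤ, n ≠ 0 → (1 : ℝ) ≤ |(n : ℝ)| := by
    intro n hn
    exact_mod_cast Int.one_le_abs hn
  have hpos : 0 < 1 + l + 1 / l := by positivity
  have h1 : 1 / (1 + l + 1 / l) ≤ l := by
    rw [div_le_iff₀ hpos]
    have : l * (1 / l) = 1 := by field_simp
    nlinarith
  have h2 : 1 / (1 + l + 1 / l) ≤ 1 := by
    rw [div_le_one hpos]
    have : 0 < 1 / l := by positivity
    linarith
  have h3 : 1 / (1 + l + 1 / l) ≤ 1 / l :=
    one_div_le_one_div_of_le hl (by have : 0 < 1 / l := by positivity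
                                    linarith)
  have key : ∀ T : (Fin 3 → ℝ) →ₗ[ℝ] (Fin 3 → ℝ),
      (∀ z : Fin 3 → ℤ, z ≠ 0 → 1 / (1 + l + 1 / l) ≤ ‖T (castVec z)‖) →
      1 / minNorm T ≤ 1 + l + 1 / l := by
    intro T hT
    have := one_div_le_one_div_of_le (by positivity) (le_minNorm hT)
    rwa [one_div_one_div] at this
  have hP := key (primalMap f g l x) fun z hz => by
    rw [norm_primalMap f g hl]
    obtain ⟨g0, g1, g2⟩ := frameSize_le_iff.1 (le_refl (frameSize l
      (castVec z 2 - castVec z 0 * f x - g x * (castVec z 1 - castVec z 0 * x))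
      (castVec z 1 - castVec z 0 * x) (castVec z 0)))
    by_cases z0 : z 0 = 0
    · by_cases z1 : z 1 = 0
      · have z2 : z 2 ≠ 0 := by
          intro z2; apply hz; funext i; fin_cases i <;> assumption
        refine le_trans (h3.trans ?_) g0
        gcongr
        simpa [z0, z1] using hm _ z2
      · refine le_trans (h2.trans ?_) g1
        simpa [z0] using hm _ z1
    · refine le_trans (h1.trans ?_) g2
      exact le_mul_of_one_le_right hl.le (hm _ z0)
  have hD := key (dualMap f g l x) fun z hz => by
    rw [norm_dualMap f g hl]
    obtain ⟨g0, g1, g2⟩ := frameSize_le_iff.1 (le_refl (frameSize l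
      (castVec z 0 + castVec z 1 * x + castVec z 2 * f x)
      (castVec z 1 + castVec z 2 * g x) (castVec z 2)))
    by_cases z0 : z 2 = 0
    · by_cases z1 : z 1 = 0
      · have z2 : z 0 ≠ 0 := by
          intro z2; apply hz; funext i; fin_cases i <;> assumption
        refine le_trans (h3.trans ?_) g0
        gcongr
        simpa [z0, z1] using hm _ z2
      · refine le_trans (h2.trans ?_) g1
        simpa [z0] using hm _ z1
    · refine le_trans (h1.trans ?_) g2
      exact le_mul_of_one_le_right hl.le (hm _ z0)
  rw [cuspHeight]
  linarith

lemma sum_range_mul_eq {β : Type*} [AddCommMonoid β] (m M : ℕ) (F : ℕ → β) :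
    ∑ k ∈ Finset.range (m * M), F k
      = ∑ k ∈ Finset.range m, ∑ i ∈ Finset.range M, F (k * M + i) := by
  induction m with
  | zero => simp
  | succ m ih => rw [Nat.succ_mul, Finset.sum_range_add, ih, Finset.sum_range_succ]

/-- The mean of `cuspHeight` over a grid of `M ^ n` points grows at most like `K ^ n` where
`K = O(log M)`; as `M` may be taken large, this is an arbitrarily small power of `M ^ n`. -/
lemma CurvatureBounds.sum_cuspHeight_grid_le (h : CurvatureBounds ρ ξ c C f g) (hI : ρ < ξ)
    (hc : 0 < c) (hc1 : c ≤ 1) (hC : 1 ≤ C) {M : ℕ} (hM : 0 < M) (n : ℕ) :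
    ∑ k ∈ Finset.range (M ^ n), cuspHeight f g ((ξ - ρ) / M ^ n) (ρ + k * ((ξ - ρ) / M ^ n))
      ≤ M ^ n * ((12 * C ^ 2 / c * (3 + 2 * Real.log M) + 1) ^ n *
        (2 * (1 + (ξ - ρ) + 1 / (ξ - ρ)) + (3 * C * M) ^ 2) - (3 * C * M) ^ 2) := by
  have hV : 0 < ξ - ρ := sub_pos.2 hI
  have hM0 : (0 : ℝ) < M := by exact_mod_cast hM
  set K := 12 * C ^ 2 / c * (3 + 2 * Real.log M) + 1 with hK
  have hK2 : 2 ≤ K := by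
    have hlog : 0 ≤ Real.log M := Real.log_natCast_nonneg M
    have h1 : 12 ≤ 12 * C ^ 2 / c := by
      rw [le_div_iff₀ hc]; nlinarith
    nlinarith
  set E := (3 * C * M) ^ 2 with hE
  have hE0 : 0 ≤ E := by positivity
  induction n with
  | zero =>
    simpa using cuspHeight_le f g hV ρ
  | succ n ih =>
    rw [pow_succ M n, sum_range_mul_eq]
    obtain ⟨l, hl⟩ : ∃ l, l = (ξ - ρ) / (M : ℝ) ^ n := ⟨_, rfl⟩
    rw [← hl] at ih
    have hl0 : 0 < l := by rw [hl]; positivity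
    have hle : (ξ - ρ) / (M : ℝ) ^ (n + 1) = l / M := by rw [hl, pow_succ]; field_simp
    have step : ∀ k ∈ Finset.range (M ^ n), ∑ i ∈ Finset.range M,
        cuspHeight f g ((ξ - ρ) / (M : ℝ) ^ (n + 1))
          (ρ + ((k * M + i : ℕ) : ℝ) * ((ξ - ρ) / (M : ℝ) ^ (n + 1)))
        ≤ M * (K * cuspHeight f g l (ρ + k * l) + E) := by
      intro k hk
      have hk' : (k : ℝ) + 1 ≤ (M : ℝ) ^ n := by
        exact_mod_cast Finset.mem_range.1 hk
      have e : ∀ i : ℕ, ρ + ((k * M + i : ℕ) : ℝ) * ((ξ - ρ) / (M : ℝ) ^ (n + 1))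
          = (ρ + k * l) + i * (l / M) := by
        intro i
        rw [hle]
        push_cast
        field_simp
        ring
      refine le_trans (le_of_eq (Finset.sum_congr rfl fun i _ => by rw [e i, hle]))
        (h.sum_cuspHeight_children_le hc hc1 hC hl0 hM (x := ρ + k * l) fun i hi => ?_)
      have hi' : (i : ℝ) ≤ M := by exact_mod_cast hi
      have b1 : (i : ℝ) * (l / M) ≤ l := by
        calc (i : ℝ) * (l / M) ≤ M * (l / M) := by gcongr
          _ = l := by field_simp
      have b2 : ((k : ℝ) + 1) * l ≤ ξ - ρ := by
        calc ((k : ℝ) + 1) * l ≤ (M : ℝ) ^ n * l := by gcongr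
          _ = ξ - ρ := by rw [hl]; field_simp
      have b3 : 0 ≤ (i : ℝ) * (l / M) := by positivity
      have b4 : 0 ≤ (k : ℝ) * l := by positivity
      constructor <;> linarith
    refine (Finset.sum_le_sum step).trans ?_
    rw [← Finset.mul_sum, Finset.sum_add_distrib, ← Finset.mul_sum, Finset.sum_const,
      Finset.card_range, nsmul_eq_mul, pow_succ (M : ℝ), pow_succ K]
    push_cast
    have h0 : K * ∑ k ∈ Finset.range (M ^ n), cuspHeight f g l (ρ + k * l) ≤ K * _ :=
      mul_le_mul_of_nonneg_left ih (by linarith)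
    set P := (M : ℝ) ^ n
    have hP0 : 0 < P := by positivity
    have h1 : K * (P * (K ^ n * (2 * (1 + (ξ - ρ) + 1 / (ξ - ρ)) + E) - E)) + P * E
        ≤ P * (K ^ n * K * (2 * (1 + (ξ - ρ) + 1 / (ξ - ρ)) + E) - E) := by
      have : 0 ≤ P * E * (K - 2) := mul_nonneg (mul_nonneg hP0.le hE0) (by linarith)
      nlinarith
    calc _ ≤ (M : ℝ) * (P * (K ^ n * K * (2 * (1 + (ξ - ρ) + 1 / (ξ - ρ)) + E) - E)) :=
          mul_le_mul_of_nonneg_left (by linarith) hM0.le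
      _ = _ := by ring

end

/-! ### Counting lattice points by averaging over translates -/

section
open MeasureTheory
open scoped ENNReal

/-- The number of points of a translate of the lattice `T ℤ³` in `K`, averaged over a fundamental
domain of translations, is the volume of `K`. -/
lemma volume_eq_lintegral_encard {T : (Fin 3 → ℝ) →ₗ[ℝ] (Fin 3 → ℝ)} (hT : LinearMap.det T = 1)
    {K : Set (Fin 3 → ℝ)} (hK : MeasurableSet K) :
    volume K = ∫⁻ t in ZSpan.fundamentalDomain (Pi.basisFun ℝ (Fin 3)),
      (({z : Fin 3 → ℤ | T (castVec z + t) ∈ K}.encard : ℕ∞) : ℝ≥0∞) := by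
  set b := Pi.basisFun ℝ (Fin 3)
  have hTm : Measurable T := T.continuous_of_finiteDimensional.measurable
  have hTK : MeasurableSet (T ⁻¹' K) := hTm hK
  have h1 : volume (T ⁻¹' K) = volume K := by
    rw [Measure.addHaar_preimage_linearMap volume (by rw [hT]; exact one_ne_zero), hT]
    simp
  let e : (Fin 3 → ℤ) ≃ Submodule.span ℤ (Set.range b) :=
    (b.restrictScalars ℤ).equivFun.symm.toEquiv
  have he : ∀ z, ((e z : Submodule.span ℤ (Set.range b)) : Fin 3 → ℝ) = castVec z := by
    intro z
    have : e z = ∑ i, z i • (b.restrictScalars ℤ) i := (b.restrictScalars ℤ).equivFun_symm_apply z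
    rw [this]
    funext j
    simp [b, Module.Basis.restrictScalars_apply, Finset.sum_apply, Pi.single_apply]
  have : VAddInvariantMeasure (Submodule.span ℤ (Set.range b)) (Fin 3 → ℝ) volume :=
    inferInstanceAs (VAddInvariantMeasure (Submodule.span ℤ (Set.range b)).toAddSubgroup _ _)
  have : MeasurableConstVAdd (Submodule.span ℤ (Set.range b)) (Fin 3 → ℝ) :=
    inferInstanceAs (MeasurableConstVAdd (Submodule.span ℤ (Set.range b)).toAddSubgroup _)
  rw [← h1, ← lintegral_indicator_one hTK,
    (ZSpan.isAddFundamentalDomain b volume).lintegral_eq_tsum'',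
    ← lintegral_tsum]
  · refine lintegral_congr fun t => ?_
    rw [← e.tsum_eq, ← ENNReal.tsum_set_one, tsum_subtype _ (fun _ => (1 : ℝ≥0∞))]
    refine tsum_congr fun z => ?_
    have : (e z +ᵥ t : Fin 3 → ℝ) = castVec z + t := by
      rw [← he]; rfl
    rw [this]
    rfl
  · intro z
    refine Measurable.aemeasurable ?_
    exact (measurable_one.indicator hTK).comp (measurable_const_vadd _)

lemma volume_fundamentalDomain_basisFun :
    volume (ZSpan.fundamentalDomain (Pi.basisFun ℝ (Fin 3))) = 1 := by
  rw [ZSpan.fundamentalDomain_pi_basisFun, Real.volume_pi_Ico]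
  simp

lemma volume_le_of_encard_le {T : (Fin 3 → ℝ) →ₗ[ℝ] (Fin 3 → ℝ)} (hT : LinearMap.det T = 1)
    {K : Set (Fin 3 → ℝ)} (hK : MeasurableSet K) {n : ℕ∞}
    (h : ∀ t, {z : Fin 3 → ℤ | T (castVec z + t) ∈ K}.encard ≤ n) : volume K ≤ n := by
  rw [volume_eq_lintegral_encard hT hK]
  refine (lintegral_mono fun t => ENat.toENNReal_le.2 (h t)).trans (le_of_eq ?_)
  rw [setLIntegral_const, volume_fundamentalDomain_basisFun, mul_one]

lemma le_volume_of_le_encard {T : (Fin 3 → ℝ) →ₗ[ℝ] (Fin 3 → ℝ)} (hT : LinearMap.det T = 1)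
    {K : Set (Fin 3 → ℝ)} (hK : MeasurableSet K) {n : ℕ∞}
    (h : ∀ t, n ≤ {z : Fin 3 → ℤ | T (castVec z + t) ∈ K}.encard) : n ≤ volume K := by
  rw [volume_eq_lintegral_encard hT hK]
  refine le_trans (le_of_eq ?_) (lintegral_mono fun t => ENat.toENNReal_le.2 (h t))
  rw [setLIntegral_const, volume_fundamentalDomain_basisFun, mul_one]

/-- If `K` contains the `μ`-neighbourhood of the points `T S`, and `μ` is a covering radius of
`T ℤ³`, then `S` has at most `volume K` elements. -/
lemma encard_le_volume {T : (Fin 3 → ℝ) →ₗ[ℝ] (Fin 3 → ℝ)} (hT : LinearMap.det T = 1) {μ : ℝ}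
    (hμ : ∀ t, ∃ w : Fin 3 → ℤ, ‖T (t - castVec w)‖ ≤ μ) {K : Set (Fin 3 → ℝ)}
    (hK : MeasurableSet K) {S : Set (Fin 3 → ℤ)}
    (hS : ∀ z ∈ S, ∀ e, ‖e‖ ≤ μ → T (castVec z) + e ∈ K) : (S.encard : ℝ≥0∞) ≤ volume K := by
  refine le_volume_of_le_encard hT hK fun t => ?_
  obtain ⟨w, hw⟩ := hμ t
  refine Set.encard_le_encard_of_injOn (f := fun z => z - w) (fun z hz => ?_)
    (sub_left_injective.injOn)
  have := hS z hz _ hw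
  rw [← map_add] at this
  simp only [Set.mem_ofPred_eq, castVec_sub]
  convert this using 2
  abel

/-- If `S` contains every integer vector whose image is in the `μ`-neighbourhood of `K`, and `μ` is
a covering radius of `T ℤ³`, then `S` has at least `volume K` elements. -/
lemma volume_le_encard {T : (Fin 3 → ℝ) →ₗ[ℝ] (Fin 3 → ℝ)} (hT : LinearMap.det T = 1) {μ : ℝ}
    (hμ : ∀ t, ∃ w : Fin 3 → ℤ, ‖T (t - castVec w)‖ ≤ μ) {K : Set (Fin 3 → ℝ)}
    (hK : MeasurableSet K) {S : Set (Fin 3 → ℤ)}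
    (hS : ∀ z, ∀ e, ‖e‖ ≤ μ → T (castVec z) + e ∈ K → z ∈ S) :
    volume K ≤ (S.encard : ℝ≥0∞) := by
  refine volume_le_of_encard_le hT hK fun t => ?_
  obtain ⟨w, hw⟩ := hμ t
  refine Set.encard_le_encard_of_injOn (f := fun z => z + w) (fun z hz => ?_)
    ((add_left_injective w).injOn)
  refine hS _ _ hw ?_
  rw [← map_add]
  simp only [Set.mem_ofPred_eq] at hz
  convert hz using 2
  rw [castVec_add]; abel

/-- Three linearly independent lattice vectors of length at most `R` give the covering radius
`3 R / 2`. -/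
lemma exists_norm_map_sub_le {T : (Fin 3 → ℝ) →ₗ[ℝ] (Fin 3 → ℝ)} {R : ℝ}
    {b : Fin 3 → Fin 3 → ℤ} (hb : LinearIndependent ℝ fun i => castVec (b i))
    (hbR : ∀ i, ‖T (castVec (b i))‖ ≤ R) (t : Fin 3 → ℝ) :
    ∃ w : Fin 3 → ℤ, ‖T (t - castVec w)‖ ≤ 3 / 2 * R := by
  let β := basisOfLinearIndependentOfCardEqFinrank hb (by simp)
  have hβ : ∀ i, β i = castVec (b i) := fun i => by simp [β]
  refine ⟨∑ i, round (β.repr t i) • b i, ?_⟩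
  have e : t - castVec (∑ i, round (β.repr t i) • b i)
      = ∑ i, (β.repr t i - round (β.repr t i)) • castVec (b i) := by
    have h1 : castVec (∑ i, round (β.repr t i) • b i)
        = ∑ i, (round (β.repr t i) : ℝ) • castVec (b i) := by
      simp only [Fin.sum_univ_three, castVec_add, castVec_smul]
    have h2 : t = ∑ i, β.repr t i • castVec (b i) := by
      conv_lhs => rw [← β.sum_repr t]
      simp only [hβ]
    simp only [sub_smul, Finset.sum_sub_distrib]
    rw [h1, ← h2]
  rw [e, map_sum]
  refine (norm_sum_le _ _).trans ?_
  have : ∀ i ∈ Finset.univ, ‖T ((β.repr t i - round (β.repr t i)) • castVec (b i))‖ ≤ 1 / 2 * R := by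
    intro i _
    rw [map_smul, norm_smul, Real.norm_eq_abs]
    exact mul_le_mul (abs_sub_round _) (hbR i) (norm_nonneg _) (by norm_num)
  refine (Finset.sum_le_card_nsmul _ _ _ this).trans (le_of_eq ?_)
  simp; ring

end

/-! ### Lattice points in a plane -/

lemma card_le_of_separated {ι : Type*} (s : Finset ι) (x : ι → ℝ) {R d : ℝ} (hR : 0 ≤ R)
    (hd : 0 < d) (hx : ∀ i ∈ s, |x i| ≤ R) (hsep : ∀ i ∈ s, ∀ j ∈ s, i ≠ j → d ≤ |x i - x j|) :
    (s.card : ℝ) ≤ 2 * R / d + 1 := by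
  have h1 : s.card ≤ (Finset.Icc (0 : ℤ) ⌊2 * R / d⌋).card := by
    refine Finset.card_le_card_of_injOn (fun i => ⌊(x i + R) / d⌋) (fun i hi => ?_) ?_
    · have := abs_le.1 (hx i hi)
      simp only [Finset.coe_Icc, Set.mem_Icc]
      refine ⟨Int.floor_nonneg.2 (div_nonneg (by linarith) hd.le), Int.floor_le_floor ?_⟩
      gcongr
      linarith
    · intro i hi j hj hij
      by_contra hne
      have h2 := Int.abs_sub_lt_one_of_floor_eq_floor hij
      rw [← sub_div, abs_div, abs_of_pos hd, div_lt_one hd, add_sub_add_right_eq_sub] at h2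
      exact absurd (hsep i hi j hj hne) (not_le.2 h2)
  have h2 : 0 ≤ ⌊2 * R / d⌋ := Int.floor_nonneg.2 (by positivity)
  rw [Int.card_Icc] at h1
  have h3 : (s.card : ℤ) ≤ ⌊2 * R / d⌋ + 1 := by omega
  have h4 : (s.card : ℝ) ≤ (⌊2 * R / d⌋ : ℝ) + 1 := by exact_mod_cast h3
  linarith [Int.floor_le (2 * R / d)]

lemma card_le_of_collinear {ι : Type*} (s : Finset ι) (φ : ι → Fin 3 → ℝ) {R d : ℝ} (hR : 0 ≤ R)
    (hd : 0 < d) (u : Fin 3 → ℝ) (hu : ∀ i ∈ s, ∀ j ∈ s, ∃ t : ℝ, φ i - φ j = t • u)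
    (hφ : ∀ i ∈ s, ‖φ i‖ ≤ R) (hsep : ∀ i ∈ s, ∀ j ∈ s, i ≠ j → d ≤ ‖φ i - φ j‖) :
    (s.card : ℝ) ≤ 2 * R / d + 1 := by
  obtain ⟨k, hk⟩ : ∃ k, |u k| = ‖u‖ := by
    rw [norm_fin_three]
    rcases max_choice |u 0| (max |u 1| |u 2|) with h | h <;> rw [h]
    · exact ⟨0, rfl⟩
    · rcases max_choice |u 1| |u 2| with h | h <;> rw [h]
      exacts [⟨1, rfl⟩, ⟨2, rfl⟩]
  refine card_le_of_separated s (fun i => φ i k) hR hd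
    (fun i hi => (norm_le_pi_norm (φ i) k).trans (hφ i hi)) fun i hi j hj hij => ?_
  refine (hsep i hi j hj hij).trans (le_of_eq ?_)
  obtain ⟨t, ht⟩ := hu i hi j hj
  have : φ i k - φ j k = t * u k := by
    have := congrFun ht k
    simpa using this
  rw [this, ht, norm_smul, abs_mul, hk, Real.norm_eq_abs]

lemma linearIndependent_of_cross_cross_ne_zero {u v w : Fin 3 → ℝ}
    (h : (v ⨯₃ u) ⨯₃ (w ⨯₃ u) ≠ 0) : LinearIndependent ℝ ![u, v, w] := by
  have key : LinearIndependent ℝ (Matrix.of ![u, v, w]).row := by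
    rw [Matrix.linearIndependent_rows_iff_isUnit, Matrix.isUnit_iff_isUnit_det, isUnit_iff_ne_zero]
    intro hdet
    apply h
    rw [Matrix.det_fin_three] at hdet
    simp at hdet
    rw [cross_apply, cross_apply, cross_apply]
    funext i
    fin_cases i
    · simp; linear_combination (u 0) * hdet
    · simp; linear_combination (u 1) * hdet
    · simp; linear_combination (u 2) * hdet
  exact key

/-- Lattice vectors of length at most `R` that do not span space: group them into lines parallel
to the shortest vector; the lines correspond to collinear vectors of the dual lattice. -/
lemma ncard_le_of_not_span {A B : (Fin 3 → ℝ) →ₗ[ℝ] (Fin 3 → ℝ)} (hA : Function.Injective A)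
    (hB : Function.Injective B) (hAB : ∀ v w, B (v ⨯₃ w) = A v ⨯₃ A w) {R : ℝ}
    (hR : minNorm A ≤ R)
    (hspan : ¬ ∃ b : Fin 3 → Fin 3 → ℤ, LinearIndependent ℝ (fun i => castVec (b i)) ∧
      ∀ i, ‖A (castVec (b i))‖ ≤ R) :
    ({z : Fin 3 → ℤ | ‖A (castVec z)‖ ≤ R}.ncard : ℝ)
      ≤ 12 * R ^ 2 / minNorm B + 3 * R / minNorm A := by
  have hposA := minNorm_pos hA
  have hposB := minNorm_pos hB
  have hR0 : 0 ≤ R := hposA.le.trans hR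
  obtain ⟨u, hu0, hu⟩ := exists_norm_eq_minNorm hA
  have hcu : castVec u ≠ 0 := mt castVec_eq_zero.1 hu0
  have hfin := finite_norm_map_castVec_le hA R
  set S := hfin.toFinset with hS
  have hmem : ∀ z, z ∈ S ↔ ‖A (castVec z)‖ ≤ R := fun z => by simp [hS]
  rw [Set.ncard_eq_toFinset_card _ hfin]
  have hlines : ∀ w ∈ S.image (fun z => z ⨯₃ u),
      (S.filter fun z => z ⨯₃ u = w).card ≤ ⌊2 * R / minNorm A + 1⌋₊ := by
    intro w _
    refine Nat.le_floor (card_le_of_collinear _ (fun z => A (castVec z)) hR0 hposA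
      (A (castVec u)) ?_ ?_ ?_)
    · intro z hz z' hz'
      rw [Finset.mem_filter] at hz hz'
      have : castVec (z - z') ⨯₃ castVec u = 0 := by
        rw [← castVec_cross, castVec_eq_zero, map_sub, LinearMap.sub_apply, hz.2, hz'.2, sub_self]
      obtain ⟨t, ht⟩ := eq_smul_of_cross_eq_zero hcu this
      exact ⟨t, by rw [← map_sub, ← castVec_sub, ht, map_smul]⟩
    · intro z hz
      exact (hmem z).1 (Finset.mem_filter.1 hz).1
    · intro z _ z' _ hne
      rw [← map_sub, ← castVec_sub]
      exact minNorm_le A (sub_ne_zero.2 hne)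
  have himg : ((S.image fun z => z ⨯₃ u).card : ℝ)
      ≤ 2 * (2 * (R * minNorm A)) / minNorm B + 1 := by
    obtain ⟨d, hd⟩ : ∃ d : Fin 3 → ℝ, ∀ w ∈ S.image (fun z => z ⨯₃ u),
        ∃ t : ℝ, castVec w = t • d := by
      by_cases hall : ∀ w ∈ S.image (fun z => z ⨯₃ u), castVec w = 0
      · exact ⟨0, fun w hw => ⟨0, by simp [hall w hw]⟩⟩
      · push Not at hall
        obtain ⟨w₀, hw₀, hne⟩ := hall
        refine ⟨castVec w₀, fun w hw => eq_smul_of_cross_eq_zero hne ?_⟩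
        obtain ⟨z, hz, rfl⟩ := Finset.mem_image.1 hw
        obtain ⟨z₀, hz₀, rfl⟩ := Finset.mem_image.1 hw₀
        by_contra hcross
        rw [castVec_cross, castVec_cross] at hcross
        refine hspan ⟨![u, z, z₀], ?_, ?_⟩
        · convert linearIndependent_of_cross_cross_ne_zero hcross using 1
          funext i
          fin_cases i <;> rfl
        · intro i
          fin_cases i
          exacts [hu.trans_le hR, (hmem z).1 hz, (hmem z₀).1 hz₀]
    refine card_le_of_collinear _ (fun w => B (castVec w)) (by positivity) hposB (B d) ?_ ?_ ?_
    · intro w hw w' hw'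
      obtain ⟨t, ht⟩ := hd w hw
      obtain ⟨t', ht'⟩ := hd w' hw'
      exact ⟨t - t', by rw [ht, ht', map_smul, map_smul, sub_smul]⟩
    · intro w hw
      obtain ⟨z, hz, rfl⟩ := Finset.mem_image.1 hw
      rw [castVec_cross, hAB]
      refine (norm_cross_le _ _).trans ?_
      rw [hu]
      have := (hmem z).1 hz
      gcongr
    · intro w _ w' _ hne
      rw [← map_sub, ← castVec_sub]
      exact minNorm_le B (sub_ne_zero.2 hne)
  have hcard : (S.card : ℝ) ≤ (⌊2 * R / minNorm A + 1⌋₊ : ℝ) * (S.image fun z => z ⨯₃ u).card := by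
    exact_mod_cast Finset.card_le_mul_card_image S _ hlines
  have hfl : (⌊2 * R / minNorm A + 1⌋₊ : ℝ) ≤ 2 * R / minNorm A + 1 :=
    Nat.floor_le (by positivity)
  have hone : 1 ≤ R / minNorm A := (one_le_div hposA).2 hR
  calc (S.card : ℝ) ≤ (⌊2 * R / minNorm A + 1⌋₊ : ℝ) * (S.image fun z => z ⨯₃ u).card := hcard
    _ ≤ (3 * (R / minNorm A)) * (2 * (2 * (R * minNorm A)) / minNorm B + 1) := by
        have h3 : (⌊2 * R / minNorm A + 1⌋₊ : ℝ) ≤ 3 * (R / minNorm A) :=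
          hfl.trans (by rw [mul_div_assoc]; linarith)
        exact mul_le_mul h3 himg (Nat.cast_nonneg _) (by positivity)
    _ = _ := by field_simp; ring

section
open MeasureTheory
open scoped ENNReal

/-- Minkowski's theorem in quantitative form, by the pigeonhole principle. -/
lemma cube_le_ncard {T : (Fin 3 → ℝ) →ₗ[ℝ] (Fin 3 → ℝ)} (hT : LinearMap.det T = 1) {R : ℝ}
    (hR : 0 ≤ R) : R ^ 3 ≤ ({z : Fin 3 → ℤ | ‖T (castVec z)‖ ≤ R}.ncard : ℝ) := by
  have hfin := finite_norm_map_castVec_le (injective_of_det_eq_one hT) R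
  have h : volume (Metric.closedBall (0 : Fin 3 → ℝ) (R / 2))
      ≤ (({z : Fin 3 → ℤ | ‖T (castVec z)‖ ≤ R}.encard : ℕ∞) : ℝ≥0∞) := by
    refine volume_le_of_encard_le hT Metric.isClosed_closedBall.measurableSet fun t => ?_
    rcases Set.eq_empty_or_nonempty
      {z : Fin 3 → ℤ | T (castVec z + t) ∈ Metric.closedBall (0 : Fin 3 → ℝ) (R / 2)} with he | he
    · rw [he]; simp
    · obtain ⟨z₀, hz₀⟩ := he
      refine Set.encard_le_encard_of_injOn (f := fun z => z - z₀) (fun z hz => ?_)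
        (sub_left_injective.injOn)
      simp only [Set.mem_ofPred_eq, mem_closedBall_zero_iff] at hz hz₀ ⊢
      have e : castVec (z - z₀) = (castVec z + t) - (castVec z₀ + t) := by
        rw [castVec_sub]; abel
      rw [e, map_sub]
      linarith [norm_sub_le (T (castVec z + t)) (T (castVec z₀ + t))]
  rw [Real.volume_pi_closedBall _ (by positivity), ← hfin.cast_ncard_eq] at h
  rw [Fintype.card_fin, show 2 * (R / 2) = R by ring, ENat.toENNReal_coe,
    ENNReal.ofReal_le_natCast] at h
  · exact h

lemma minNorm_le_one {T : (Fin 3 → ℝ) →ₗ[ℝ] (Fin 3 → ℝ)} (hT : LinearMap.det T = 1) :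
    minNorm T ≤ 1 := by
  by_contra hcon
  push Not at hcon
  set R := (1 + minNorm T) / 2 with hR
  have hR1 : 1 < R := by rw [hR]; linarith
  have h1 := cube_le_ncard hT (by linarith : 0 ≤ R)
  have h2 : {z : Fin 3 → ℤ | ‖T (castVec z)‖ ≤ R} ⊆ {0} := by
    intro z hz
    by_contra hz0
    have h3 : ‖T (castVec z)‖ ≤ R := hz
    have := minNorm_le T (z := z) hz0
    rw [hR] at h3
    linarith
  have h3 := Set.ncard_le_ncard h2
  rw [Set.ncard_singleton] at h3
  have h4 : ({z : Fin 3 → ℤ | ‖T (castVec z)‖ ≤ R}.ncard : ℝ) ≤ 1 := by exact_mod_cast h3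
  have h5 : 1 < R ^ 3 := one_lt_pow₀ hR1 (by norm_num)
  linarith

lemma cube_le_of_not_span {A B : (Fin 3 → ℝ) →ₗ[ℝ] (Fin 3 → ℝ)} (hA : LinearMap.det A = 1)
    (hB : Function.Injective B) (hAB : ∀ v w, B (v ⨯₃ w) = A v ⨯₃ A w) {R : ℝ} (hR : 0 ≤ R)
    (hspan : ¬ ∃ b : Fin 3 → Fin 3 → ℤ, LinearIndependent ℝ (fun i => castVec (b i)) ∧
      ∀ i, ‖A (castVec (b i))‖ ≤ R) :
    R ^ 3 ≤ 12 * R ^ 2 / minNorm B + 3 * R / minNorm A := by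
  have hinj := injective_of_det_eq_one hA
  have hposA := minNorm_pos hinj
  have hposB := minNorm_pos hB
  rcases le_or_gt (minNorm A) R with h | h
  · exact (cube_le_ncard hA hR).trans (ncard_le_of_not_span hinj hB hAB h hspan)
  · have h1 := minNorm_le_one hA
    have h2 : R ^ 3 ≤ R := pow_le_of_le_one hR (by linarith) (by norm_num)
    have h3 : R ≤ R / minNorm A := le_div_self hR hposA h1
    have h4 : 0 ≤ 12 * R ^ 2 / minNorm B := by positivity
    have h5 : 3 * R / minNorm A = 3 * (R / minNorm A) := mul_div_assoc _ _ _
    linarith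

/-! ### Lattice points in a pyramid -/

/-- The pyramid over a rectangle, half open, in which the rational points near an arc lie in frame
coordinates. -/
def pyramid (g r : ℝ) : Set (Fin 3 → ℝ) :=
  {X | 0 < X 0 ∧ X 0 ≤ r ∧ 0 ≤ X 1 ∧ X 1 < X 0 ∧ |X 2| < g * X 0}

lemma measurableSet_pyramid (g r : ℝ) : MeasurableSet (pyramid g r) := by
  have h : ∀ i : Fin 3, Measurable fun X : Fin 3 → ℝ => X i := fun i => measurable_pi_apply i
  refine (measurableSet_lt measurable_const (h 0)).inter
    ((measurableSet_le (h 0) measurable_const).inter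
    ((measurableSet_le measurable_const (h 1)).inter ((measurableSet_lt (h 1) (h 0)).inter
    (measurableSet_lt (h 2).abs (measurable_const.mul (h 0))))))

lemma volume_pyramid {g r : ℝ} (hg : 0 < g) (hr : 0 ≤ r) :
    volume (pyramid g r) = ENNReal.ofReal (2 * g / 3 * r ^ 3) := by
  have hmp := volume_preserving_piFinSuccAbove (fun _ : Fin 3 => ℝ) 0
  set P : Set (ℝ × (Fin 2 → ℝ)) := {p | 0 < p.1 ∧ p.1 ≤ r ∧ 0 ≤ p.2 0 ∧ p.2 0 < p.1 ∧
    |p.2 1| < g * p.1} with hP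
  have hpre : pyramid g r = MeasurableEquiv.piFinSuccAbove (fun _ : Fin 3 => ℝ) 0 ⁻¹' P := by
    ext X
    rfl
  have hPm : MeasurableSet P := by
    have := measurableSet_pyramid g r
    rw [hpre] at this
    exact (MeasurableEquiv.measurableSet_preimage _).1 this
  rw [hpre, hmp.measure_preimage hPm.nullMeasurableSet, Measure.volume_eq_prod,
    Measure.prod_apply hPm]
  have hslice : ∀ s : ℝ, volume (Prod.mk s ⁻¹' P)
      = (Set.Ioc 0 r).indicator (fun s => ENNReal.ofReal (2 * g * s ^ 2)) s := by
    intro s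
    by_cases hs : s ∈ Set.Ioc 0 r
    · rw [Set.indicator_of_mem hs]
      have : Prod.mk s ⁻¹' P = Set.univ.pi ![Set.Ico 0 s, Set.Ioo (-(g * s)) (g * s)] := by
        ext y
        simp only [hP, Set.mem_preimage, Set.mem_ofPred_eq, Set.mem_univ_pi, Fin.forall_fin_two,
          Matrix.cons_val_zero, Matrix.cons_val_one, Set.mem_Ico, Set.mem_Ioo, abs_lt, hs.1, hs.2,
          true_and]
        tauto
      rw [this, volume_pi_pi, Fin.prod_univ_two]
      simp only [Matrix.cons_val_zero, Matrix.cons_val_one, Real.volume_Ico, Real.volume_Ioo]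
      rw [← ENNReal.ofReal_mul (by linarith [hs.1])]
      congr 1; ring
    · rw [Set.indicator_of_notMem hs]
      have : Prod.mk s ⁻¹' P = ∅ := by
        ext y
        simp only [hP, Set.mem_preimage, Set.mem_ofPred_eq, Set.mem_empty_iff_false, iff_false]
        exact fun h => hs ⟨h.1, h.2.1⟩
      rw [this, measure_empty]
  rw [lintegral_congr hslice, lintegral_indicator measurableSet_Ioc,
    ← ofReal_integral_eq_lintegral_ofReal]
  · congr 1
    rw [← intervalIntegral.integral_of_le hr, intervalIntegral.integral_const_mul, integral_pow]
    norm_num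
    ring
  · exact (Continuous.integrableOn_Icc (by fun_prop)).mono_set Set.Ioc_subset_Icc_self
  · exact Filter.Eventually.of_forall fun s => by positivity

/-- If the lattice vectors of length `θ r` span space, the covering radius is `O(θ r)`, and
thickening or thinning the pyramid by that much gives the number of lattice points in it. -/
lemma abs_ncard_pyramid_sub_le_of_span {A : (Fin 3 → ℝ) →ₗ[ℝ] (Fin 3 → ℝ)}
    (hA : LinearMap.det A = 1) {g r θ : ℝ} (hg : 0 < g) (hr : 0 < r) (hθ : 0 < θ)
    (hgθ : (6 + 3 / (2 * g)) * θ ≤ 1) {S : Set (Fin 3 → ℤ)} (hfin : S.Finite)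
    (hS : ∀ z, A (castVec z) ∈ pyramid g r → z ∈ S)
    (hS' : ∀ z ∈ S, 0 < A (castVec z) 0 ∧ A (castVec z) 0 ≤ r ∧ 0 ≤ A (castVec z) 1 ∧
      A (castVec z) 1 ≤ A (castVec z) 0 ∧ |A (castVec z) 2| < g * A (castVec z) 0)
    {b : Fin 3 → Fin 3 → ℤ} (hb : LinearIndependent ℝ fun i => castVec (b i))
    (hbR : ∀ i, ‖A (castVec (b i))‖ ≤ θ * r) :
    |(S.ncard : ℝ) - 2 * g / 3 * r ^ 3| ≤ (28 * g + 7) * θ * r ^ 3 := by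
  set μ := 3 / 2 * (θ * r) with hμ
  have hμ0 : 0 < μ := by positivity
  have hcov := exists_norm_map_sub_le hb hbR
  rw [← hμ] at hcov
  -- shifting the pyramid by `p` along its axis makes room for a `μ`-neighbourhood
  set p := (3 + 1 / g) * μ with hp
  have hgp : g * (p - μ) = 2 * g * μ + μ := by rw [hp]; field_simp; ring
  have hp3 : 3 * μ < p := by
    rw [hp]
    have : 0 < 1 / g * μ := by positivity
    linarith
  set ω := (6 + 3 / (2 * g)) * θ with hω
  have hω0 : 0 < ω := by positivity
  have hωr : μ + p = ω * r := by
    rw [hp, hω, hμ]; field_simp; ring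
  set P : Fin 3 → ℝ := ![p, μ, 0] with hPdef
  have hP0 : P 0 = p := rfl
  have hP1 : P 1 = μ := rfl
  have hP2 : P 2 = 0 := rfl
  have hvol : ∀ v : Fin 3 → ℝ, ∀ s, volume ((fun X => v + X) ⁻¹' pyramid g s)
      = volume (pyramid g s) := fun v s => measure_preimage_add _ _ _
  have hmeas : ∀ v : Fin 3 → ℝ, ∀ s, MeasurableSet ((fun X => v + X) ⁻¹' pyramid g s) :=
    fun v s => measurable_const_add v (measurableSet_pyramid g s)
  have hup : (S.ncard : ℝ) ≤ 2 * g / 3 * ((1 + ω) * r) ^ 3 := by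
    have h := encard_le_volume hA hcov (hmeas P (r + μ + p)) (S := S) ?_
    · rw [hvol, volume_pyramid hg (by linarith), ← hfin.cast_ncard_eq, ENat.toENNReal_coe,
        ← ENNReal.ofReal_natCast, ENNReal.ofReal_le_ofReal_iff (by positivity)] at h
      convert h using 3
      linarith
    · intro z hz e he
      obtain ⟨h0, h1, h2, h3, h4⟩ := hS' z hz
      obtain ⟨e0, e1, e2⟩ := norm_fin_three_le_iff.1 he
      rw [abs_le] at e0 e1
      have t := abs_add_le (A (castVec z) 2) (e 2)
      have hge : g * (A (castVec z) 0 + p - μ) ≤ g * (p + (A (castVec z) 0 + e 0)) :=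
        mul_le_mul_of_nonneg_left (by linarith) hg.le
      have hgm : 0 < g * μ := by positivity
      refine ⟨?_, ?_, ?_, ?_, ?_⟩ <;> simp only [Pi.add_apply, hP0, hP1, hP2]
      · linarith
      · linarith
      · linarith
      · linarith
      · rw [zero_add]
        nlinarith
  have hlow : 2 * g / 3 * ((1 - ω) * r) ^ 3 ≤ (S.ncard : ℝ) := by
    have hr' : 0 ≤ (1 - ω) * r := mul_nonneg (by linarith) hr.le
    have h := volume_le_encard hA hcov (hmeas (-P) ((1 - ω) * r)) (S := S) ?_
    · rw [hvol, volume_pyramid hg hr', ← hfin.cast_ncard_eq, ENat.toENNReal_coe,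
        ← ENNReal.ofReal_natCast, ENNReal.ofReal_le_ofReal_iff (by positivity)] at h
      exact h
    · intro z e he hz
      obtain ⟨h0, h1, h2, h3, h4⟩ := hz
      obtain ⟨e0, e1, e2⟩ := norm_fin_three_le_iff.1 he
      rw [abs_le] at e0 e1
      simp only [Pi.add_apply, Pi.neg_apply, hP0, hP1, hP2, neg_zero, zero_add] at h0 h1 h2 h3 h4
      have t := abs_sub (A (castVec z) 2 + e 2) (e 2)
      rw [add_sub_cancel_right] at t
      have hge : g * (-p + (A (castVec z) 0 + e 0)) ≤ g * (A (castVec z) 0 - p + μ) :=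
        mul_le_mul_of_nonneg_left (by linarith) hg.le
      have hgm : 0 < g * μ := by positivity
      refine hS z ⟨?_, ?_, ?_, ?_, ?_⟩
      · linarith
      · linarith
      · linarith
      · linarith
      · nlinarith
  have hω7 : 2 * g / 3 * (7 * ω) ≤ (28 * g + 7) * θ := by
    have : 2 * g / 3 * (7 * ω) = (28 * g + 7) * θ := by rw [hω]; field_simp; ring
    exact this.le
  have hr3 : 0 < r ^ 3 := by positivity
  have hmain : 2 * g / 3 * (7 * ω) * r ^ 3 ≤ (28 * g + 7) * θ * r ^ 3 :=
    mul_le_mul_of_nonneg_right hω7 hr3.le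
  have hu3 : (1 + ω) ^ 3 ≤ 1 + 7 * ω := by nlinarith [mul_pos hω0 hω0]
  have hl3 : 1 - 7 * ω ≤ (1 - ω) ^ 3 := by nlinarith [mul_pos hω0 hω0]
  have hu4 : 2 * g / 3 * ((1 + ω) * r) ^ 3 ≤ 2 * g / 3 * ((1 + 7 * ω) * r ^ 3) := by
    rw [mul_pow]; gcongr
  have hl4 : 2 * g / 3 * ((1 - 7 * ω) * r ^ 3) ≤ 2 * g / 3 * ((1 - ω) * r) ^ 3 := by
    rw [mul_pow]; gcongr
  rw [abs_le]
  constructor <;> linarith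

/-- Counting lattice points in the pyramid `pyramid g r`, up to a small multiple `θ` of its volume
and up to errors governed by the shortest vectors of the lattice and of its dual. When the
vectors of length `θ r` do not span space, `r ^ 3` is itself bounded by the error term. -/
lemma abs_ncard_pyramid_sub_le {A B : (Fin 3 → ℝ) →ₗ[ℝ] (Fin 3 → ℝ)} (hA : LinearMap.det A = 1)
    (hB : Function.Injective B) (hAB : ∀ v w, B (v ⨯₃ w) = A v ⨯₃ A w) {g H r θ : ℝ}
    (hg : 0 < g) (hgH : g ≤ H) (hH : 1 ≤ H) (hr : 0 < r) (hθ : 0 < θ) (hθ1 : θ ≤ 1)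
    (hgθ : (6 + 3 / (2 * g)) * θ ≤ 1) {S : Set (Fin 3 → ℤ)}
    (hS : ∀ z, A (castVec z) ∈ pyramid g r → z ∈ S)
    (hS' : ∀ z ∈ S, 0 < A (castVec z) 0 ∧ A (castVec z) 0 ≤ r ∧ 0 ≤ A (castVec z) 1 ∧
      A (castVec z) 1 ≤ A (castVec z) 0 ∧ |A (castVec z) 2| < g * A (castVec z) 0) :
    S.Finite ∧ |(S.ncard : ℝ) - 2 * g / 3 * r ^ 3|
      ≤ (28 * g + 7) * θ * r ^ 3 + 1500 * H ^ 3 / θ ^ 2 * (r ^ 2 / minNorm B + r / minNorm A) := by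
  have hinj := injective_of_det_eq_one hA
  have hposA := minNorm_pos hinj
  have hposB := minNorm_pos hB
  have hSH : S ⊆ {z : Fin 3 → ℤ | ‖A (castVec z)‖ ≤ H * r} := by
    intro z hz
    obtain ⟨h0, h1, h2, h3, h4⟩ := hS' z hz
    have hrH : r ≤ H * r := le_mul_of_one_le_left hr.le hH
    refine norm_fin_three_le_iff.2 ⟨?_, ?_, ?_⟩
    · rw [abs_of_pos h0]; linarith
    · rw [abs_of_nonneg h2]; linarith
    · refine h4.le.trans ?_
      exact mul_le_mul hgH h1 h0.le (by linarith)
  have hfinH := finite_norm_map_castVec_le hinj (H * r)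
  have hfin : S.Finite := hfinH.subset hSH
  refine ⟨hfin, ?_⟩
  set E := r ^ 2 / minNorm B + r / minNorm A with hE
  have hE0 : 0 ≤ E := by positivity
  by_cases hspan : ∃ b : Fin 3 → Fin 3 → ℤ, LinearIndependent ℝ (fun i => castVec (b i)) ∧
      ∀ i, ‖A (castVec (b i))‖ ≤ θ * r
  · obtain ⟨b, hb, hbR⟩ := hspan
    have := abs_ncard_pyramid_sub_le_of_span hA hg hr hθ hgθ hfin hS hS' hb hbR
    have hCE : 0 ≤ 1500 * H ^ 3 / θ ^ 2 * E := by positivity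
    linarith
  · have hcube := cube_le_of_not_span hA hB hAB (by positivity : 0 ≤ θ * r) hspan
    have hr3 : r ^ 3 ≤ 12 / θ ^ 2 * E := by
      have h1 : (θ * r) ^ 3 ≤ θ * (12 * E) := by
        refine hcube.trans ?_
        have e1 : 12 * (θ * r) ^ 2 / minNorm B = θ * (12 * (θ * (r ^ 2 / minNorm B))) := by ring
        have e2 : 3 * (θ * r) / minNorm A = θ * (3 * (r / minNorm A)) := by ring
        rw [e1, e2, ← mul_add]
        gcongr
        have h2 : θ * (r ^ 2 / minNorm B) ≤ r ^ 2 / minNorm B :=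
          mul_le_of_le_one_left (by positivity) hθ1
        have h3 : 0 ≤ r / minNorm A := by positivity
        rw [hE]; linarith
      have h2 : θ ^ 2 * r ^ 3 ≤ 12 * E := by
        refine le_of_mul_le_mul_left ?_ hθ
        calc θ * (θ ^ 2 * r ^ 3) = (θ * r) ^ 3 := by ring
          _ ≤ _ := h1
      rw [div_mul_eq_mul_div, le_div_iff₀ (by positivity)]
      linarith
    have hH3 : H ≤ H ^ 3 := le_self_pow₀ hH (by norm_num)
    have hvolE : 2 * g / 3 * r ^ 3 ≤ 1500 * H ^ 3 / θ ^ 2 * E := by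
      calc 2 * g / 3 * r ^ 3 ≤ H ^ 3 * (12 / θ ^ 2 * E) := by
            refine mul_le_mul ?_ hr3 (by positivity) (by positivity)
            linarith
        _ = 12 * (H ^ 3 / θ ^ 2 * E) := by ring
        _ ≤ 1500 * (H ^ 3 / θ ^ 2 * E) := by
            have : 0 ≤ H ^ 3 / θ ^ 2 * E := by positivity
            linarith
        _ = _ := by ring
    have hSE : (S.ncard : ℝ) ≤ 1500 * H ^ 3 / θ ^ 2 * E := by
      have hle : (S.ncard : ℝ) ≤ ({z : Fin 3 → ℤ | ‖A (castVec z)‖ ≤ H * r}.ncard : ℝ) := by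
        exact_mod_cast Set.ncard_le_ncard hSH hfinH
      rcases lt_or_ge (H * r) (minNorm A) with hlt | hge
      · have : S = ∅ := by
          refine Set.eq_empty_of_forall_notMem fun z hz => ?_
          have hz0 : z ≠ 0 := by
            rintro rfl
            have := (hS' 0 hz).1
            rw [castVec_eq_zero.2 rfl, map_zero] at this
            exact lt_irrefl _ this
          have h1 : ‖A (castVec z)‖ ≤ H * r := hSH hz
          linarith [minNorm_le A hz0]
        rw [this, Set.ncard_empty, Nat.cast_zero]
        positivity
      · by_cases hspanH : ∃ b : Fin 3 → Fin 3 → ℤ,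
            LinearIndependent ℝ (fun i => castVec (b i)) ∧ ∀ i, ‖A (castVec (b i))‖ ≤ H * r
        · obtain ⟨b, hb, hbR⟩ := hspanH
          have h := encard_le_volume hA (exists_norm_map_sub_le hb hbR)
            (K := Metric.closedBall 0 (5 / 2 * (H * r))) Metric.isClosed_closedBall.measurableSet
            (S := {z : Fin 3 → ℤ | ‖A (castVec z)‖ ≤ H * r}) (fun z hz e he => by
              have h1 : ‖A (castVec z)‖ ≤ H * r := hz
              rw [mem_closedBall_zero_iff]
              linarith [norm_add_le (A (castVec z)) e])
          rw [Real.volume_pi_closedBall _ (by positivity), ← hfinH.cast_ncard_eq,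
            ENat.toENNReal_coe, ← ENNReal.ofReal_natCast,
            ENNReal.ofReal_le_ofReal_iff (by positivity), Fintype.card_fin] at h
          calc (S.ncard : ℝ) ≤ (2 * (5 / 2 * (H * r))) ^ 3 := hle.trans h
            _ = 125 * H ^ 3 * r ^ 3 := by ring
            _ ≤ 125 * H ^ 3 * (12 / θ ^ 2 * E) := by gcongr
            _ = _ := by ring
        · refine hle.trans ((ncard_le_of_not_span hinj hB hAB hge hspanH).trans ?_)
          have e1 : 12 * (H * r) ^ 2 / minNorm B = 12 * H ^ 2 * (r ^ 2 / minNorm B) := by ring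
          have e2 : 3 * (H * r) / minNorm A = 3 * H * (r / minNorm A) := by ring
          have hH2 : H ≤ H ^ 2 := le_self_pow₀ hH (by norm_num)
          have hH23 : H ^ 2 ≤ H ^ 3 := pow_le_pow_right₀ hH (by norm_num)
          rw [e1, e2]
          calc 12 * H ^ 2 * (r ^ 2 / minNorm B) + 3 * H * (r / minNorm A)
              ≤ 12 * H ^ 2 * (r ^ 2 / minNorm B) + 12 * H ^ 2 * (r / minNorm A) := by
                gcongr; linarith
            _ = 12 * H ^ 2 * E := by rw [hE]; ring
            _ ≤ 1500 * H ^ 3 / θ ^ 2 * E := by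
                gcongr
                rw [le_div_iff₀ (by positivity)]
                have : θ ^ 2 ≤ 1 := pow_le_one₀ hθ.le hθ1
                have h0 : 0 ≤ H ^ 2 := by positivity
                nlinarith
    have h0 : 0 ≤ (28 * g + 7) * θ * r ^ 3 := by positivity
    have h1 : 0 ≤ 2 * g / 3 * r ^ 3 := by positivity
    rw [abs_le]
    have h2 : (0 : ℝ) ≤ S.ncard := Nat.cast_nonneg _
    constructor <;> linarith

end

/-! ### Primitive vectors and Möbius inversion -/

section
open ArithmeticFunction

/-- The greatest common divisor of the coordinates `(q, a, b)`, in the order of `countNear`. -/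
def content (z : Fin 3 → ℤ) : ℕ := Int.gcd (z 1) (Int.gcd (z 2) (z 0))

lemma dvd_content_iff {d : ℕ} {z : Fin 3 → ℤ} :
    d ∣ content z ↔ ∃ w : Fin 3 → ℤ, (d : ℤ) • w = z := by
  have h1 : d ∣ content z ↔ (d : ℤ) ∣ z 1 ∧ (d : ℤ) ∣ z 2 ∧ (d : ℤ) ∣ z 0 := by
    rw [content, Int.dvd_gcd_iff, Int.natCast_dvd_natCast, Int.dvd_gcd_iff]
  rw [h1]
  constructor
  · rintro ⟨⟨a, ha⟩, ⟨b, hb⟩, ⟨q, hq⟩⟩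
    refine ⟨![q, a, b], ?_⟩
    funext i
    fin_cases i <;> simp [ha, hb, hq]
  · rintro ⟨w, rfl⟩
    simp

lemma content_ne_zero {z : Fin 3 → ℤ} (hz : z 0 ≠ 0) : content z ≠ 0 := by
  simp [content, Int.gcd_eq_zero_iff, hz]

lemma content_le {z : Fin 3 → ℤ} (hz : 0 < z 0) : (content z : ℤ) ≤ z 0 := by
  refine Int.le_of_dvd hz ?_
  exact ((Int.gcd_dvd_right _ _).trans (Int.gcd_dvd_right _ _))

lemma sum_moebius_Icc_dvd {n D : ℕ} (hn : n ≠ 0) (hD : n ≤ D) :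
    ∑ d ∈ (Finset.Icc 1 D).filter (· ∣ n), moebius d = if n = 1 then 1 else 0 := by
  have h1 : (Finset.Icc 1 D).filter (· ∣ n) = n.divisors := by
    ext d
    simp only [Finset.mem_filter, Finset.mem_Icc, Nat.mem_divisors]
    constructor
    · rintro ⟨-, h⟩
      exact ⟨h, hn⟩
    · rintro ⟨h, -⟩
      exact ⟨⟨Nat.pos_of_dvd_of_pos h (Nat.pos_of_ne_zero hn),
        (Nat.le_of_dvd (Nat.pos_of_ne_zero hn) h).trans hD⟩, h⟩
  rw [h1, ← coe_mul_zeta_apply, moebius_mul_coe_zeta, one_apply]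

lemma ncard_content_eq_one {S : Set (Fin 3 → ℤ)} (hS : S.Finite) {D : ℕ}
    (hS0 : ∀ z ∈ S, content z ≠ 0) (hSD : ∀ z ∈ S, content z ≤ D) :
    ({z ∈ S | content z = 1}.ncard : ℤ)
      = ∑ d ∈ Finset.Icc 1 D, moebius d * ({w : Fin 3 → ℤ | (d : ℤ) • w ∈ S}.ncard : ℤ) := by
  classical
  set s := hS.toFinset with hs
  have hmem : ∀ z, z ∈ s ↔ z ∈ S := fun z => by simp [hs]
  have h1 : {z ∈ S | content z = 1} = ↑(s.filter fun z => content z = 1) := by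
    ext z; simp [hmem]
  have h2 : ∀ d ∈ Finset.Icc 1 D, ({w : Fin 3 → ℤ | (d : ℤ) • w ∈ S}.ncard : ℤ)
      = ∑ z ∈ s, if d ∣ content z then 1 else 0 := by
    intro d hd
    have hd0 : (d : ℤ) ≠ 0 := by
      have := (Finset.mem_Icc.1 hd).1
      exact_mod_cast (by omega : d ≠ 0)
    have hinj : Function.Injective fun w : Fin 3 → ℤ => (d : ℤ) • w := smul_right_injective _ hd0
    have : (fun w : Fin 3 → ℤ => (d : ℤ) • w) '' {w : Fin 3 → ℤ | (d : ℤ) • w ∈ S}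
        = ↑(s.filter fun z => d ∣ content z) := by
      ext z
      simp only [Set.mem_image, Set.mem_ofPred_eq, Finset.coe_filter, hmem, dvd_content_iff]
      constructor
      · rintro ⟨w, hw, rfl⟩
        exact ⟨hw, w, rfl⟩
      · rintro ⟨hz, w, rfl⟩
        exact ⟨w, hz, rfl⟩
    rw [← Set.ncard_image_of_injective _ hinj, this, Set.ncard_coe_finset, Finset.sum_boole]
  rw [h1, Set.ncard_coe_finset, Finset.sum_congr rfl fun d hd => by rw [h2 d hd, Finset.mul_sum],
    Finset.sum_comm, ← Finset.sum_boole]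
  refine Finset.sum_congr rfl fun z hz => ?_
  rw [← sum_moebius_Icc_dvd (hS0 z ((hmem z).1 hz)) (hSD z ((hmem z).1 hz)), Finset.sum_filter]
  refine Finset.sum_congr rfl fun d _ => ?_
  split_ifs <;> simp

lemma sum_Icc_inv_cube_le (D : ℕ) : ∑ d ∈ Finset.Icc 1 D, 1 / (d : ℝ) ^ 3 ≤ 2 := by
  have key : ∀ n : ℕ, ∑ d ∈ Finset.Icc 1 (n + 1), 1 / (d : ℝ) ^ 3 ≤ 2 - 1 / ((n : ℝ) + 1) := by
    intro n
    induction n with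
    | zero => simp; norm_num
    | succ n ih =>
      rw [Finset.sum_Icc_succ_top (by omega)]
      have : 1 / (((n + 1 + 1 : ℕ) : ℝ)) ^ 3 ≤ 1 / ((n : ℝ) + 1) - 1 / ((n : ℝ) + 1 + 1) := by
        have e : 1 / ((n : ℝ) + 1) - 1 / ((n : ℝ) + 1 + 1) = 1 / (((n : ℝ) + 1) * (n + 1 + 1)) := by
          field_simp; ring
        rw [e]
        push_cast
        refine one_div_le_one_div_of_le (by positivity) ?_
        have : (0 : ℝ) ≤ n := Nat.cast_nonneg n
        nlinarith [sq_nonneg ((n : ℝ) + 1 + 1)]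
      push_cast at this ih ⊢
      linarith
  rcases D with _ | n
  · simp
  · have : 0 ≤ 1 / ((n : ℝ) + 1) := by positivity
    linarith [key n]

lemma sum_Icc_inv_le (D : ℕ) : ∑ d ∈ Finset.Icc 1 D, 1 / (d : ℝ) ≤ 1 + Real.log D := by
  have h := harmonic_le_one_add_log D
  rw [harmonic_eq_sum_Icc] at h
  push_cast at h
  simpa [one_div] using h

lemma abs_moebius_cast_le_one (d : ℕ) : |(moebius d : ℝ)| ≤ 1 := by
  have := abs_moebius_le_one (n := d)
  exact_mod_cast this

/-- The density of the primitive vectors, up to level `D`. -/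
noncomputable def moebiusCubeSum (D : ℕ) : ℝ := ∑ d ∈ Finset.Icc 1 D, (moebius d : ℝ) / (d : ℝ) ^ 3

lemma abs_moebiusCubeSum_le (D : ℕ) : |moebiusCubeSum D| ≤ 2 := by
  refine (Finset.abs_sum_le_sum_abs _ _).trans (le_trans (Finset.sum_le_sum fun d _ => ?_)
    (sum_Icc_inv_cube_le D))
  rw [abs_div, abs_of_nonneg (by positivity : (0 : ℝ) ≤ (d : ℝ) ^ 3)]
  exact div_le_div_of_nonneg_right (abs_moebius_cast_le_one d) (by positivity)

/-- The count of primitive lattice points in a pyramid. A vector divisible by `d` is `d` times a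
vector in the pyramid of height `r / d`, so that Möbius inversion applies. -/
lemma abs_ncard_primitive_pyramid_sub_le {A B : (Fin 3 → ℝ) →ₗ[ℝ] (Fin 3 → ℝ)}
    (hA : LinearMap.det A = 1) (hB : Function.Injective B)
    (hAB : ∀ v w, B (v ⨯₃ w) = A v ⨯₃ A w) {g H r θ : ℝ}
    (hg : 0 < g) (hgH : g ≤ H) (hH : 1 ≤ H) (hr : 0 < r) (hθ : 0 < θ) (hθ1 : θ ≤ 1)
    (hgθ : (6 + 3 / (2 * g)) * θ ≤ 1) {S : Set (Fin 3 → ℤ)}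
    (hS : ∀ z, A (castVec z) ∈ pyramid g r → z ∈ S)
    (hS' : ∀ z ∈ S, 0 < A (castVec z) 0 ∧ A (castVec z) 0 ≤ r ∧ 0 ≤ A (castVec z) 1 ∧
      A (castVec z) 1 ≤ A (castVec z) 0 ∧ |A (castVec z) 2| < g * A (castVec z) 0)
    {D : ℕ} (hS0 : ∀ z ∈ S, content z ≠ 0) (hSD : ∀ z ∈ S, content z ≤ D) :
    S.Finite ∧ |({z ∈ S | content z = 1}.ncard : ℝ) - 2 * g / 3 * r ^ 3 * moebiusCubeSum D|
      ≤ 2 * ((28 * g + 7) * θ * r ^ 3)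
        + 1500 * H ^ 3 / θ ^ 2 * (1 + Real.log D) * (r ^ 2 / minNorm B + r / minNorm A) := by
  have hposA := minNorm_pos (injective_of_det_eq_one hA)
  have hposB := minNorm_pos hB
  have hfin : S.Finite := (abs_ncard_pyramid_sub_le hA hB hAB hg hgH hH hr hθ hθ1 hgθ hS hS').1
  refine ⟨hfin, ?_⟩
  have h0 := ncard_content_eq_one hfin hS0 hSD
  have h0' : ({z ∈ S | content z = 1}.ncard : ℝ) = ∑ d ∈ Finset.Icc 1 D,
      (moebius d : ℝ) * ({w : Fin 3 → ℤ | (d : ℤ) • w ∈ S}.ncard : ℝ) := by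
    exact_mod_cast congrArg (Int.cast : ℤ → ℝ) h0
  set E := r ^ 2 / minNorm B + r / minNorm A with hE
  set F := 1500 * H ^ 3 / θ ^ 2 with hF
  have hF0 : 0 ≤ F := by positivity
  have key : ∀ d ∈ Finset.Icc 1 D, |(moebius d : ℝ) *
      ({w : Fin 3 → ℤ | (d : ℤ) • w ∈ S}.ncard : ℝ)
        - 2 * g / 3 * r ^ 3 * ((moebius d : ℝ) / (d : ℝ) ^ 3)|
      ≤ (28 * g + 7) * θ * r ^ 3 * (1 / (d : ℝ) ^ 3) + F * E * (1 / (d : ℝ)) := by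
    intro d hd
    have hd1 : 1 ≤ d := (Finset.mem_Icc.1 hd).1
    have hd1' : (1 : ℝ) ≤ d := by exact_mod_cast hd1
    have hd0 : (0 : ℝ) < d := by linarith
    have hmap : ∀ w : Fin 3 → ℤ, ∀ i, A (castVec ((d : ℤ) • w)) i = d * A (castVec w) i := by
      intro w i
      rw [castVec_smul, map_smul, Pi.smul_apply, smul_eq_mul, Int.cast_natCast]
    obtain ⟨-, h⟩ := abs_ncard_pyramid_sub_le hA hB hAB hg hgH hH (div_pos hr hd0) hθ hθ1 hgθ
      (S := {w : Fin 3 → ℤ | (d : ℤ) • w ∈ S})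
      (fun w hw => by
        obtain ⟨a0, a1, a2, a3, a4⟩ := hw
        rw [le_div_iff₀ hd0] at a1
        refine hS _ ⟨?_, ?_, ?_, ?_, ?_⟩ <;> simp only [hmap]
        · positivity
        · linarith
        · positivity
        · exact mul_lt_mul_of_pos_left a3 hd0
        · rw [abs_mul, abs_of_pos hd0, mul_left_comm]
          exact mul_lt_mul_of_pos_left a4 hd0)
      (fun w hw => by
        obtain ⟨a0, a1, a2, a3, a4⟩ := hS' _ hw
        simp only [hmap] at a0 a1 a2 a3 a4
        rw [abs_mul, abs_of_pos hd0, mul_left_comm] at a4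
        refine ⟨pos_of_mul_pos_right a0 hd0.le, ?_, nonneg_of_mul_nonneg_right a2 hd0,
          le_of_mul_le_mul_left a3 hd0, lt_of_mul_lt_mul_left a4 hd0.le⟩
        rw [le_div_iff₀ hd0]
        linarith)
    have e1 : (moebius d : ℝ) * ({w : Fin 3 → ℤ | (d : ℤ) • w ∈ S}.ncard : ℝ)
        - 2 * g / 3 * r ^ 3 * ((moebius d : ℝ) / (d : ℝ) ^ 3)
        = (moebius d : ℝ) * (({w : Fin 3 → ℤ | (d : ℤ) • w ∈ S}.ncard : ℝ)
          - 2 * g / 3 * (r / d) ^ 3) := by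
      rw [div_pow]; ring
    rw [e1, abs_mul]
    refine (mul_le_of_le_one_left (abs_nonneg _) (abs_moebius_cast_le_one d)).trans (h.trans ?_)
    have e2 : (28 * g + 7) * θ * (r / d) ^ 3 = (28 * g + 7) * θ * r ^ 3 * (1 / (d : ℝ) ^ 3) := by
      rw [div_pow]; ring
    have e3 : (r / d) ^ 2 / minNorm B + r / d / minNorm A ≤ E * (1 / (d : ℝ)) := by
      have a1 : (r / d) ^ 2 / minNorm B = r ^ 2 / minNorm B * (1 / (d : ℝ)) * (1 / (d : ℝ)) := by
        field_simp
      have a2 : r / d / minNorm A = r / minNorm A * (1 / (d : ℝ)) := by field_simp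
      have a3 : 1 / (d : ℝ) ≤ 1 := by rw [div_le_one hd0]; exact hd1'
      have a4 : r ^ 2 / minNorm B * (1 / (d : ℝ)) * (1 / (d : ℝ))
          ≤ r ^ 2 / minNorm B * (1 / (d : ℝ)) :=
        mul_le_of_le_one_right (by positivity) a3
      rw [a1, a2, hE, add_mul]
      linarith
    rw [e2, mul_assoc F]
    have := mul_le_mul_of_nonneg_left e3 hF0
    linarith
  have hE0 : 0 ≤ E := by positivity
  rw [h0', moebiusCubeSum, Finset.mul_sum, ← Finset.sum_sub_distrib]
  refine (Finset.abs_sum_le_sum_abs _ _).trans ((Finset.sum_le_sum key).trans ?_)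
  rw [Finset.sum_add_distrib, ← Finset.mul_sum, ← Finset.mul_sum]
  have b1 := mul_le_mul_of_nonneg_left (sum_Icc_inv_cube_le D)
    (by positivity : 0 ≤ (28 * g + 7) * θ * r ^ 3)
  have b2 := mul_le_mul_of_nonneg_left (sum_Icc_inv_le D) (by positivity : 0 ≤ F * E)
  linarith

lemma riemannZeta_three : riemannZeta 3 = ((∑' n : ℕ, 1 / (n : ℝ) ^ 3 : ℝ) : ℂ) := by
  have := zeta_nat_eq_tsum_of_gt_one (k := 3) (by norm_num)
  push_cast at this ⊢
  exact this

lemma zeta3_eq_tsum : zeta3 = ∑' n : ℕ, 1 / (n : ℝ) ^ 3 := by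
  rw [zeta3, riemannZeta_three, Complex.ofReal_re]

lemma zeta3_pos : 0 < zeta3 := by
  rw [zeta3_eq_tsum]
  have hs : Summable fun n : ℕ => 1 / (n : ℝ) ^ 3 := Real.summable_one_div_nat_pow.2 (by norm_num)
  exact hs.tsum_pos (fun n => by positivity) 1 (by norm_num)

lemma tendsto_moebiusCubeSum : Tendsto moebiusCubeSum atTop (nhds (1 / zeta3)) := by
  have hre : (1 : ℝ) < (3 : ℂ).re := by norm_num
  have hz : riemannZeta 3 = (zeta3 : ℂ) := by rw [riemannZeta_three, zeta3_eq_tsum]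
  have hL := LSeries_zeta_mul_Lseries_moebius hre
  rw [LSeries_zeta_eq_riemannZeta hre, hz] at hL
  have hsum := (LSeriesSummable_moebius_iff.2 hre).hasSum
  have hterm : ∀ n : ℕ, LSeries.term (fun n => ((moebius n : ℤ) : ℂ)) 3 n
      = (((moebius n : ℝ) / (n : ℝ) ^ 3 : ℝ) : ℂ) := by
    intro n
    rcases eq_or_ne n 0 with rfl | hn
    · simp
    · rw [LSeries.term_of_ne_zero hn]
      push_cast
      congr 1
      exact_mod_cast Complex.cpow_natCast (n : ℂ) 3
  have hval : LSeries (fun n => ((moebius n : ℤ) : ℂ)) 3 = ((1 / zeta3 : ℝ) : ℂ) := by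
    have hz0 : (zeta3 : ℂ) ≠ 0 := by exact_mod_cast zeta3_pos.ne'
    push_cast
    rw [eq_div_iff hz0, mul_comm]
    exact hL
  have hsum' : HasSum (fun n : ℕ => (((moebius n : ℝ) / (n : ℝ) ^ 3 : ℝ) : ℂ))
      ((1 / zeta3 : ℝ) : ℂ) := by
    rw [← hval]
    have := hsum
    rw [funext hterm] at this
    convert this using 1
    rw [LSeries, ← tsum_congr hterm]
  have hr : HasSum (fun n : ℕ => (moebius n : ℝ) / (n : ℝ) ^ 3) (1 / zeta3) :=
    Complex.hasSum_ofReal.1 hsum'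
  have ht := (hr.tendsto_sum_nat).comp (tendsto_add_atTop_nat 1)
  refine ht.congr fun D => ?_
  simp only [Function.comp_apply, moebiusCubeSum]
  rw [Finset.range_eq_Ico, Finset.sum_eq_sum_Ico_succ_bot (by omega)]
  simp
  rfl

end

/-! ### Rational points near the arc as lattice points in pyramids -/

section
variable {ρ ξ c C : ℝ} {f g : ℝ → ℝ}

/-- The triples counted by `countNear`, written as integer vectors `(q, a, b)`. -/
def nearVectors (ρ ξ : ℝ) (f : ℝ → ℝ) (Q δ : ℝ) : Set (Fin 3 → ℤ) :=
  {z | 1 ≤ z 0 ∧ (z 0 : ℝ) ≤ Q ∧ (z 1 : ℝ) / (z 0 : ℝ) ∈ Set.Icc ρ ξ ∧ content z = 1 ∧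
    |f ((z 1 : ℝ) / (z 0 : ℝ)) - (z 2 : ℝ) / (z 0 : ℝ)| < δ / Q}

lemma countNear_eq_ncard (ρ ξ : ℝ) (f : ℝ → ℝ) (Q δ : ℝ) :
    countNear ρ ξ f Q δ = (nearVectors ρ ξ f Q δ).ncard := by
  have hinj : Function.Injective fun z : Fin 3 → ℤ => (z 1, z 2, z 0) := by
    intro z w h
    simp only [Prod.mk.injEq] at h
    funext i
    fin_cases i
    exacts [h.2.2, h.1, h.2.1]
  rw [countNear, ← Set.ncard_image_of_injective _ hinj]
  congr 1
  ext ⟨a, b, q⟩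
  simp only [Set.mem_ofPred_eq, Set.mem_image, nearVectors, Prod.mk.injEq]
  constructor
  · intro h
    exact ⟨![q, a, b], by simpa [content] using h, by simp⟩
  · rintro ⟨z, hz, rfl, rfl, rfl⟩
    simpa [content] using hz

/-- For a fraction `a / q` at distance at most `l` from `x`, replacing the curve by its tangent at
`x` changes the height by at most `C l ^ 2`. -/
lemma CurvatureBounds.abs_sub_tangent_le (h : CurvatureBounds ρ ξ c C f g) (hC : 0 ≤ C) {l x : ℝ}
    (hl : 0 < l) (hx : x ∈ Set.Icc ρ ξ) {q a b : ℝ} (hq : 0 < q) (hy : a / q ∈ Set.Icc ρ ξ)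
    (hyx : |a / q - x| ≤ l) :
    |(b - q * f x - g x * (a - q * x)) / l - (l * q) * ((b / q - f (a / q)) / l ^ 2)|
      ≤ C * (l * q) := by
  have h1 := h.tangent x hx (a / q) hy
  have e : (b - q * f x - g x * (a - q * x)) / l - (l * q) * ((b / q - f (a / q)) / l ^ 2)
      = q / l * (f (a / q) - f x - g x * (a / q - x)) := by
    field_simp
    ring
  rw [e, abs_mul, abs_of_pos (by positivity)]
  have h2 : (a / q - x) ^ 2 ≤ l ^ 2 := by
    rw [← sq_abs]
    exact pow_le_pow_left₀ (abs_nonneg _) hyx 2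
  calc q / l * |f (a / q) - f x - g x * (a / q - x)| ≤ q / l * (C * l ^ 2) := by
        gcongr
        exact h1.trans (mul_le_mul_of_nonneg_left h2 hC)
    _ = C * (l * q) := by field_simp

lemma exists_grid_interval {N : ℕ} (hN : 0 < N) {l : ℝ} (hl : 0 < l) (hlN : N * l = ξ - ρ) {y : ℝ}
    (hy : y ∈ Set.Icc ρ ξ) : ∃ k < N, ρ + k * l ≤ y ∧ y ≤ ρ + k * l + l := by
  have hy0 : 0 ≤ (y - ρ) / l := div_nonneg (by linarith [hy.1]) hl.le
  by_cases h : ⌊(y - ρ) / l⌋₊ < N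
  · have h1 := Nat.floor_le hy0
    have h2 := (Nat.lt_floor_add_one ((y - ρ) / l)).le
    rw [le_div_iff₀ hl] at h1
    rw [div_le_iff₀ hl] at h2
    exact ⟨_, h, by linarith, by linarith⟩
  · push Not at h
    have h1 : (N : ℝ) ≤ (y - ρ) / l := (Nat.le_floor_iff hy0).1 h
    rw [le_div_iff₀ hl] at h1
    have h2 : ((N - 1 : ℕ) : ℝ) = N - 1 := by rw [Nat.cast_sub (by omega), Nat.cast_one]
    refine ⟨N - 1, by omega, ?_, ?_⟩ <;> rw [h2] <;> linarith [hy.1, hy.2]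

lemma CurvatureBounds.abs_countNear_sub_le (h : CurvatureBounds ρ ξ c C f g) (hI : ρ < ξ)
    (hC : 1 ≤ C) {N : ℕ} (hN : 0 < N) {Q δ G H θ : ℝ} (hQ : 1 ≤ Q) (hδ : 0 < δ)
    (hG : G = δ * N ^ 2 / (Q * (ξ - ρ) ^ 2)) (hCG : 2 * C ≤ G) (hGH : G + C ≤ H) (hθ : 0 < θ)
    (hθ8 : θ ≤ 1 / 8) (hr1 : 1 ≤ (ξ - ρ) / N * Q) :
    |(countNear ρ ξ f Q δ : ℝ) - 2 / 3 * ((ξ - ρ) * δ * Q ^ 2) * moebiusCubeSum ⌊Q⌋₊|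
      ≤ (ξ - ρ) * δ * Q ^ 2 * (4 * C / (3 * G) + 126 * θ)
        + 1500 * H ^ 3 / θ ^ 2 * (1 + Real.log Q) * ((ξ - ρ) / N * Q) ^ 2 *
          ∑ k ∈ Finset.range N, cuspHeight f g ((ξ - ρ) / N) (ρ + k * ((ξ - ρ) / N)) := by
  classical
  have hV : 0 < ξ - ρ := sub_pos.2 hI
  have hN0 : (0 : ℝ) < N := by exact_mod_cast hN
  have hQ0 : 0 < Q := by linarith
  obtain ⟨l, hl⟩ : ∃ l, l = (ξ - ρ) / N := ⟨_, rfl⟩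
  rw [← hl] at hr1 ⊢
  have hl0 : 0 < l := by rw [hl]; positivity
  have hNl : N * l = ξ - ρ := by rw [hl]; field_simp
  obtain ⟨r, hr⟩ : ∃ r, r = l * Q := ⟨_, rfl⟩
  rw [← hr] at hr1 ⊢
  have hr0 : 0 < r := by linarith
  have hδQ : δ / Q = G * l ^ 2 := by rw [hG, hl]; field_simp
  have hvol : N * (G * r ^ 3) = (ξ - ρ) * δ * Q ^ 2 := by
    rw [hr, hG, hl]; field_simp
  have hG0 : 0 < G := by linarith
  set x : ℕ → ℝ := fun k => ρ + k * l with hx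
  have hxI : ∀ k < N, x k ∈ Set.Icc ρ ξ := by
    intro k hk
    have h1 : (k : ℝ) ≤ N := by exact_mod_cast hk.le
    have h2 : (k : ℝ) * l ≤ N * l := by gcongr
    have h3 : 0 ≤ (k : ℝ) * l := by positivity
    constructor <;> simp only [hx] <;> linarith
  set T : ℕ → (Fin 3 → ℝ) →ₗ[ℝ] (Fin 3 → ℝ) := fun k => primalMap f g l (x k) with hT
  have hT0 : ∀ k (z : Fin 3 → ℤ), T k (castVec z) 0 = l * z 0 := fun k z => by
    simp [hT, primalMap_apply]
  have hT1 : ∀ k (z : Fin 3 → ℤ), T k (castVec z) 1 = z 1 - z 0 * x k := fun k z => by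
    simp [hT, primalMap_apply]
  have hT2 : ∀ k (z : Fin 3 → ℤ), T k (castVec z) 2
      = (z 2 - z 0 * f (x k) - g (x k) * (z 1 - z 0 * x k)) / l := fun k z => by
    simp [hT, primalMap_apply]
  -- the closed pyramids contain the points over the `k`-th interval, the half-open ones consist
  -- of such points
  set Sp : ℕ → Set (Fin 3 → ℤ) := fun k => {z | 0 < T k (castVec z) 0 ∧ T k (castVec z) 0 ≤ r ∧
    0 ≤ T k (castVec z) 1 ∧ T k (castVec z) 1 ≤ T k (castVec z) 0 ∧
    |T k (castVec z) 2| < (G + C) * T k (castVec z) 0} with hSp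
  set Sm : ℕ → Set (Fin 3 → ℤ) := fun k => {z | T k (castVec z) ∈ pyramid (G - C) r} with hSm
  have hdiv : ∀ k (z : Fin 3 → ℤ), 0 < (z 0 : ℝ) →
      (0 ≤ T k (castVec z) 1 ↔ x k ≤ (z 1 : ℝ) / z 0) ∧
      (T k (castVec z) 1 ≤ T k (castVec z) 0 ↔ (z 1 : ℝ) / z 0 ≤ x k + l) ∧
      (T k (castVec z) 1 < T k (castVec z) 0 ↔ (z 1 : ℝ) / z 0 < x k + l) := by
    intro k z hz
    rw [hT0, hT1, le_div_iff₀ hz, div_le_iff₀ hz, div_lt_iff₀ hz]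
    refine ⟨⟨fun h => by linarith, fun h => by linarith⟩, ⟨fun h => by linarith,
      fun h => by linarith⟩, ⟨fun h => by linarith, fun h => by linarith⟩⟩
  have hcover : nearVectors ρ ξ f Q δ ⊆ ⋃ k ∈ Finset.range N, {z ∈ Sp k | content z = 1} := by
    rintro z ⟨z0, zQ, zI, zc, zf⟩
    have z0' : (0 : ℝ) < z 0 := by exact_mod_cast (by omega : 0 < z 0)
    obtain ⟨k, hk, hk1, hk2⟩ := exists_grid_interval hN hl0 hNl zI
    simp only [Set.mem_iUnion]
    refine ⟨k, Finset.mem_range.2 hk, ⟨?_, ?_, ?_, ?_, ?_⟩, zc⟩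
    · rw [hT0]; positivity
    · rw [hT0, hr]; gcongr
    · exact (hdiv k z z0').1.2 hk1
    · exact (hdiv k z z0').2.1.2 hk2
    · have ht := h.abs_sub_tangent_le (by linarith) hl0 (hxI k hk) (b := z 2) z0' zI
        (by rw [abs_le]; constructor <;> simp only [hx] <;> linarith)
      rw [← hT2 k z, ← hT0 k z] at ht
      have hX0 : 0 < T k (castVec z) 0 := by rw [hT0]; positivity
      have hlt : |T k (castVec z) 0 * (((z 2 : ℝ) / z 0 - f ((z 1 : ℝ) / z 0)) / l ^ 2)|
          < G * T k (castVec z) 0 := by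
        rw [abs_mul, abs_of_pos hX0, mul_comm, abs_div, abs_of_pos (by positivity : 0 < l ^ 2),
          abs_sub_comm]
        refine mul_lt_mul_of_pos_right ?_ hX0
        rw [div_lt_iff₀ (by positivity), ← hδQ]
        exact zf
      have := abs_sub_abs_le_abs_sub (T k (castVec z) 2)
        (T k (castVec z) 0 * (((z 2 : ℝ) / z 0 - f ((z 1 : ℝ) / z 0)) / l ^ 2))
      linarith
  have hSmW : ∀ k < N, {z ∈ Sm k | content z = 1} ⊆ nearVectors ρ ξ f Q δ := by
    rintro k hk z ⟨⟨a0, a1, a2, a3, a4⟩, zc⟩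
    have z0' : (0 : ℝ) < z 0 := by
      rw [hT0] at a0
      exact pos_of_mul_pos_right a0 hl0.le
    have b1 := (hdiv k z z0').1.1 a2
    have b2 := (hdiv k z z0').2.2.1 a3
    have hkN : ((k : ℝ) + 1) * l ≤ N * l := by
      gcongr
      exact_mod_cast hk
    have zI : (z 1 : ℝ) / z 0 ∈ Set.Icc ρ ξ := by
      constructor
      · exact (hxI k hk).1.trans b1
      · simp only [hx] at b2
        linarith
    refine ⟨by exact_mod_cast z0', ?_, zI, zc, ?_⟩
    · rw [hT0, hr] at a1
      exact le_of_mul_le_mul_left a1 hl0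
    · have ht := h.abs_sub_tangent_le (by linarith) hl0 (hxI k hk) (b := z 2) z0' zI
        (by rw [abs_le]; constructor <;> linarith)
      rw [← hT2 k z, ← hT0 k z, abs_sub_comm] at ht
      have := abs_sub_abs_le_abs_sub
        (T k (castVec z) 0 * (((z 2 : ℝ) / z 0 - f ((z 1 : ℝ) / z 0)) / l ^ 2))
        (T k (castVec z) 2)
      have hlt : |T k (castVec z) 0 * (((z 2 : ℝ) / z 0 - f ((z 1 : ℝ) / z 0)) / l ^ 2)|
          < G * T k (castVec z) 0 := by linarith
      rw [abs_mul, abs_of_pos a0, mul_comm, abs_div, abs_of_pos (by positivity : 0 < l ^ 2),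
        abs_sub_comm] at hlt
      have := lt_of_mul_lt_mul_right hlt a0.le
      rwa [div_lt_iff₀ (by positivity), ← hδQ] at this
  -- the count in a single pyramid
  have hcontent : ∀ k (S : Set (Fin 3 → ℤ)), (∀ z ∈ S, 0 < T k (castVec z) 0 ∧
      T k (castVec z) 0 ≤ r) → (∀ z ∈ S, content z ≠ 0) ∧ (∀ z ∈ S, content z ≤ ⌊Q⌋₊) := by
    intro k S hS
    have hz0 : ∀ z ∈ S, 0 < z 0 ∧ (z 0 : ℝ) ≤ Q := by
      intro z hz
      obtain ⟨a0, a1⟩ := hS z hz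
      rw [hT0] at a0 a1
      rw [hr] at a1
      exact ⟨by exact_mod_cast pos_of_mul_pos_right a0 hl0.le, le_of_mul_le_mul_left a1 hl0⟩
    refine ⟨fun z hz => content_ne_zero (hz0 z hz).1.ne', fun z hz => Nat.le_floor ?_⟩
    refine le_trans ?_ (hz0 z hz).2
    exact_mod_cast content_le (hz0 z hz).1
  have hdetT : ∀ k, LinearMap.det (T k) = 1 := fun k => det_primalMap f g hl0.ne' _
  have hinjD : ∀ k, Function.Injective (dualMap f g l (x k)) := fun k =>
    injective_of_det_eq_one (det_dualMap f g hl0.ne' _)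
  have hθg : ∀ γ : ℝ, 1 ≤ γ → (6 + 3 / (2 * γ)) * θ ≤ 1 := by
    intro γ hγ
    have : 3 / (2 * γ) ≤ 3 / 2 := div_le_div_of_nonneg_left (by norm_num) (by norm_num)
      (by linarith)
    nlinarith
  set F := 1500 * H ^ 3 / θ ^ 2 * (1 + Real.log Q) with hF
  have hlogQ : 0 ≤ Real.log Q := Real.log_nonneg hQ
  have hH0 : 0 < H := by linarith
  have hF0 : 0 ≤ F := by positivity
  have hcount : ∀ γ k, C ≤ γ → γ ≤ G + C → ∀ S : Set (Fin 3 → ℤ),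
      (∀ z, T k (castVec z) ∈ pyramid γ r → z ∈ S) →
      (∀ z ∈ S, 0 < T k (castVec z) 0 ∧ T k (castVec z) 0 ≤ r ∧ 0 ≤ T k (castVec z) 1 ∧
        T k (castVec z) 1 ≤ T k (castVec z) 0 ∧ |T k (castVec z) 2| < γ * T k (castVec z) 0) →
      S.Finite ∧ |({z ∈ S | content z = 1}.ncard : ℝ)
        - 2 * γ / 3 * r ^ 3 * moebiusCubeSum ⌊Q⌋₊|
        ≤ 126 * θ * (G * r ^ 3) + F * r ^ 2 * cuspHeight f g l (x k) := by
    intro γ k hγ hγ' S hS hS'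
    have hγ1 : 1 ≤ γ := hC.trans hγ
    obtain ⟨c0, c1⟩ := hcontent k S fun z hz => ⟨(hS' z hz).1, (hS' z hz).2.1⟩
    obtain ⟨hfin, hb⟩ := abs_ncard_primitive_pyramid_sub_le (hdetT k) (hinjD k)
      (dualMap_cross f g hl0.ne' (x k)) (by linarith) (hγ'.trans hGH) (by linarith) hr0 hθ
      (by linarith) (hθg γ hγ1) hS hS' c0 c1
    refine ⟨hfin, hb.trans (add_le_add ?_ ?_)⟩
    · have h1 : 28 * γ + 7 ≤ 63 * G := by linarith
      calc 2 * ((28 * γ + 7) * θ * r ^ 3) ≤ 2 * ((63 * G) * θ * r ^ 3) := by gcongr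
        _ = _ := by ring
    · have hpP := minNorm_pos (injective_of_det_eq_one (hdetT k))
      have hpD := minNorm_pos (hinjD k)
      have hlog : Real.log (⌊Q⌋₊ : ℝ) ≤ Real.log Q := by
        refine Real.log_le_log ?_ (Nat.floor_le hQ0.le)
        exact_mod_cast Nat.floor_pos.2 hQ
      have hlog0 : 0 ≤ Real.log (⌊Q⌋₊ : ℝ) := Real.log_natCast_nonneg _
      have e1 : r ^ 2 / minNorm (dualMap f g l (x k)) + r / minNorm (T k)
          ≤ r ^ 2 * cuspHeight f g l (x k) := by
        have : r / minNorm (T k) ≤ r ^ 2 / minNorm (T k) := by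
          gcongr
          nlinarith
        have e : r ^ 2 * cuspHeight f g l (x k)
            = r ^ 2 / minNorm (T k) + r ^ 2 / minNorm (dualMap f g l (x k)) := by
          simp only [cuspHeight, hT]; ring
        linarith
      rw [mul_assoc F]
      refine mul_le_mul ?_ e1 (by positivity) hF0
      rw [hF]
      gcongr
  have hplus : ∀ k, (Sp k).Finite ∧ |({z ∈ Sp k | content z = 1}.ncard : ℝ)
      - 2 * (G + C) / 3 * r ^ 3 * moebiusCubeSum ⌊Q⌋₊|
      ≤ 126 * θ * (G * r ^ 3) + F * r ^ 2 * cuspHeight f g l (x k) := fun k =>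
    hcount (G + C) k (by linarith) le_rfl (Sp k)
      (fun z ⟨a0, a1, a2, a3, a4⟩ => ⟨a0, a1, a2, a3.le, a4⟩) fun z hz => hz
  have hminus : ∀ k, (Sm k).Finite ∧ |({z ∈ Sm k | content z = 1}.ncard : ℝ)
      - 2 * (G - C) / 3 * r ^ 3 * moebiusCubeSum ⌊Q⌋₊|
      ≤ 126 * θ * (G * r ^ 3) + F * r ^ 2 * cuspHeight f g l (x k) := fun k =>
    hcount (G - C) k (by linarith) (by linarith) (Sm k) (fun z hz => hz)
      (fun z ⟨a0, a1, a2, a3, a4⟩ => ⟨a0, a1, a2, a3.le, a4⟩)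
  have hfinp : ∀ k, {z ∈ Sp k | content z = 1}.Finite := fun k =>
    (hplus k).1.subset fun z hz => hz.1
  have hfinm : ∀ k, {z ∈ Sm k | content z = 1}.Finite := fun k =>
    (hminus k).1.subset fun z hz => hz.1
  have hfinU : (⋃ k ∈ Finset.range N, {z ∈ Sp k | content z = 1}).Finite :=
    Set.Finite.biUnion (Finset.range N).finite_toSet fun k _ => hfinp k
  have hfinW : (nearVectors ρ ξ f Q δ).Finite := hfinU.subset hcover
  have hupper : (countNear ρ ξ f Q δ : ℝ)
      ≤ ∑ k ∈ Finset.range N, ({z ∈ Sp k | content z = 1}.ncard : ℝ) := by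
    have h1 : hfinW.toFinset ⊆ (Finset.range N).biUnion fun k => (hfinp k).toFinset := by
      intro z hz
      have := hcover (hfinW.mem_toFinset.1 hz)
      simp only [Set.mem_iUnion] at this
      obtain ⟨k, hk, hz⟩ := this
      exact Finset.mem_biUnion.2 ⟨k, hk, (hfinp k).mem_toFinset.2 hz⟩
    have h2 := (Finset.card_le_card h1).trans Finset.card_biUnion_le
    rw [countNear_eq_ncard, Set.ncard_eq_toFinset_card _ hfinW]
    simp only [Set.ncard_eq_toFinset_card _ (hfinp _)]
    exact_mod_cast h2
  have hlower : ∑ k ∈ Finset.range N, ({z ∈ Sm k | content z = 1}.ncard : ℝ)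
      ≤ (countNear ρ ξ f Q δ : ℝ) := by
    have hdisj : ∀ k k', k < k' → ∀ z ∈ Sm k, z ∉ Sm k' := by
      rintro k k' hkk z ⟨a0, -, -, a3, -⟩ ⟨-, -, b2, -, -⟩
      have z0' : (0 : ℝ) < z 0 := by
        rw [hT0] at a0
        exact pos_of_mul_pos_right a0 hl0.le
      have h1 := (hdiv k z z0').2.2.1 a3
      have h2 := (hdiv k' z z0').1.1 b2
      have h3 : ((k : ℝ) + 1) * l ≤ k' * l := by
        gcongr
        exact_mod_cast hkk
      simp only [hx] at h1 h2
      linarith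
    have h1 : ((Finset.range N).biUnion fun k => (hfinm k).toFinset) ⊆ hfinW.toFinset := by
      intro z hz
      obtain ⟨k, hk, hz⟩ := Finset.mem_biUnion.1 hz
      exact hfinW.mem_toFinset.2 (hSmW k (Finset.mem_range.1 hk) ((hfinm k).mem_toFinset.1 hz))
    have h2 := Finset.card_le_card h1
    rw [Finset.card_biUnion] at h2
    · rw [countNear_eq_ncard, Set.ncard_eq_toFinset_card _ hfinW]
      simp only [Set.ncard_eq_toFinset_card _ (hfinm _)]
      exact_mod_cast h2
    · intro k _ k' _ hne
      refine Finset.disjoint_left.2 fun z hz hz' => ?_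
      have m1 := ((hfinm k).mem_toFinset.1 hz).1
      have m2 := ((hfinm k').mem_toFinset.1 hz').1
      rcases lt_or_gt_of_ne hne with hlt | hlt
      · exact hdisj k k' hlt z m1 m2
      · exact hdisj k' k hlt z m2 m1
  -- summation over the intervals
  set m := moebiusCubeSum ⌊Q⌋₊
  have hsum : ∑ k ∈ Finset.range N, (126 * θ * (G * r ^ 3) + F * r ^ 2 * cuspHeight f g l (x k))
      = 126 * θ * (N * (G * r ^ 3))
        + F * r ^ 2 * ∑ k ∈ Finset.range N, cuspHeight f g l (x k) := by
    rw [Finset.sum_add_distrib, Finset.sum_const, Finset.card_range, nsmul_eq_mul,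
      ← Finset.mul_sum]
    ring
  have hup : (countNear ρ ξ f Q δ : ℝ) ≤ N * (2 * (G + C) / 3 * r ^ 3 * m)
      + ∑ k ∈ Finset.range N, (126 * θ * (G * r ^ 3) + F * r ^ 2 * cuspHeight f g l (x k)) := by
    refine hupper.trans ((Finset.sum_le_sum fun k _ =>
      (sub_le_iff_le_add'.1 (abs_le.1 (hplus k).2).2)).trans (le_of_eq ?_))
    rw [Finset.sum_add_distrib, Finset.sum_const, Finset.card_range, nsmul_eq_mul]
  have hlo : N * (2 * (G - C) / 3 * r ^ 3 * m)
      - ∑ k ∈ Finset.range N, (126 * θ * (G * r ^ 3) + F * r ^ 2 * cuspHeight f g l (x k))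
      ≤ (countNear ρ ξ f Q δ : ℝ) := by
    refine le_trans ?_ hlower
    rw [sub_le_iff_le_add, ← Finset.sum_add_distrib]
    refine le_trans (le_of_eq ?_) (Finset.sum_le_sum fun k _ =>
      (by linarith [(abs_le.1 (hminus k).2).1] : 2 * (G - C) / 3 * r ^ 3 * m ≤ _))
    rw [Finset.sum_const, Finset.card_range, nsmul_eq_mul]
  rw [hsum, hvol] at hup hlo
  have hmC : |N * (2 * C / 3 * r ^ 3 * m)| ≤ (ξ - ρ) * δ * Q ^ 2 * (4 * C / (3 * G)) := by
    have e : N * (2 * C / 3 * r ^ 3 * m) = N * (G * r ^ 3) * (2 * C / (3 * G)) * m := by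
      field_simp
    rw [e, hvol, abs_mul, abs_of_nonneg (by positivity)]
    calc (ξ - ρ) * δ * Q ^ 2 * (2 * C / (3 * G)) * |m|
        ≤ (ξ - ρ) * δ * Q ^ 2 * (2 * C / (3 * G)) * 2 := by
          gcongr; exact abs_moebiusCubeSum_le _
      _ = _ := by ring
  have e1 : N * (2 * (G + C) / 3 * r ^ 3 * m)
      = 2 / 3 * ((ξ - ρ) * δ * Q ^ 2) * m + N * (2 * C / 3 * r ^ 3 * m) := by
    rw [← hvol]; ring
  have e2 : N * (2 * (G - C) / 3 * r ^ 3 * m)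
      = 2 / 3 * ((ξ - ρ) * δ * Q ^ 2) * m - N * (2 * C / 3 * r ^ 3 * m) := by
    rw [← hvol]; ring
  rw [e1] at hup
  rw [e2] at hlo
  obtain ⟨g1, g2⟩ := abs_le.1 hmC
  rw [abs_le]
  constructor <;> linarith

end

/-! ### Uniform asymptotics -/

lemma exists_log_le_rpow (a b : ℝ) {s : ℝ} (hs : 0 < s) :
    ∃ M : ℕ, 2 ≤ M ∧ a * (3 + 2 * Real.log M) + b ≤ (M : ℝ) ^ s := by
  have h1 : (fun x : ℝ => a * (3 + 2 * Real.log x) + b) =o[atTop] fun x : ℝ => x ^ s := by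
    have hc : ∀ k : ℝ, (fun _ : ℝ => k) =o[atTop] fun x : ℝ => x ^ s := fun k =>
      isLittleO_const_left.2 (Or.inr (tendsto_norm_atTop_atTop.comp (tendsto_rpow_atTop hs)))
    exact (((hc 3).add ((isLittleO_log_rpow_atTop hs).const_mul_left 2)).const_mul_left a).add
      (hc b)
  have h2 := (isLittleO_iff.1 h1 one_pos).and (eventually_ge_atTop 2)
  obtain ⟨M, hM, hM2⟩ := (tendsto_natCast_atTop_atTop.eventually h2).exists
  refine ⟨M, by exact_mod_cast hM2, ?_⟩
  rw [one_mul, Real.norm_eq_abs, Real.norm_eq_abs,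
    abs_of_nonneg (Real.rpow_nonneg (Nat.cast_nonneg M) s)] at hM
  exact (le_abs_self _).trans hM

lemma tendsto_log_mul_rpow_neg (a : ℝ) {s : ℝ} (hs : 0 < s) :
    Tendsto (fun Q : ℝ => a * ((1 + Real.log Q) * Q ^ (-s))) atTop (nhds 0) := by
  have h1 : Tendsto (fun Q : ℝ => Q ^ (-s)) atTop (nhds 0) := tendsto_rpow_neg_atTop hs
  have h2 : Tendsto (fun Q : ℝ => Real.log Q / Q ^ s) atTop (nhds 0) :=
    (isLittleO_log_rpow_atTop hs).tendsto_div_nhds_zero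
  have h3 := (h1.add h2).const_mul a
  rw [add_zero, mul_zero] at h3
  refine h3.congr' ?_
  filter_upwards [eventually_gt_atTop 0] with Q hQ
  rw [Real.rpow_neg hQ.le]
  ring

/-- The level `n` of the grid is chosen so that the height `δ / Q` of the neighbourhood and the
square of the length of the intervals have a ratio between `G₀` and `M ^ 2 * G₀`. -/
lemma exists_grid_level {G₀ V Q δ : ℝ} (hV : 0 < V) (hQ : 0 < Q) (hδ : 0 < δ)
    {M : ℕ} (hM : 1 < M) (h : δ ≤ G₀ * Q * V ^ 2) :
    ∃ n : ℕ, G₀ ≤ δ * ((M : ℝ) ^ n) ^ 2 / (Q * V ^ 2) ∧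
      δ * ((M : ℝ) ^ n) ^ 2 / (Q * V ^ 2) ≤ (M : ℝ) ^ 2 * G₀ := by
  have hM1 : (1 : ℝ) < M := by exact_mod_cast hM
  obtain ⟨n, hn1, hn2⟩ := exists_nat_pow_near
    (x := G₀ * Q * V ^ 2 / δ) (y := (M : ℝ) ^ 2) ((one_le_div hδ).2 h)
    (one_lt_pow₀ hM1 (by norm_num))
  refine ⟨n + 1, ?_, ?_⟩
  · rw [div_lt_iff₀ hδ, ← pow_mul, mul_comm 2, pow_mul] at hn2
    rw [le_div_iff₀ (by positivity)]
    linarith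
  · rw [le_div_iff₀ hδ] at hn1
    rw [div_le_iff₀ (by positivity)]
    calc δ * ((M : ℝ) ^ (n + 1)) ^ 2 = (M : ℝ) ^ 2 * (((M : ℝ) ^ 2) ^ n * δ) := by ring
      _ ≤ (M : ℝ) ^ 2 * (G₀ * Q * V ^ 2) := by gcongr
      _ = _ := by ring

/-- The asymptotic formula, uniformly over all arcs with the given curvature bounds. -/
lemma exists_forall_abs_countNear_sub_le {ρ ξ c C ε : ℝ} (hI : ρ < ξ) (hc : 0 < c) (hc1 : c ≤ 1)
    (hC : 1 ≤ C) (hε : 0 < ε) {η : ℝ} (hη : 0 < η) :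
    ∃ Q₀ : ℝ, 1 ≤ Q₀ ∧ ∀ f g : ℝ → ℝ, CurvatureBounds ρ ξ c C f g → ∀ Q δ : ℝ, Q₀ ≤ Q →
      Q ^ (ε - 1) < δ → δ ≤ 1 / 2 →
      |(countNear ρ ξ f Q δ : ℝ) - 2 / (3 * zeta3) * ((ξ - ρ) * δ * Q ^ 2)|
        ≤ η * ((ξ - ρ) * δ * Q ^ 2) := by
  have hV : 0 < ξ - ρ := sub_pos.2 hI
  -- `G` compares the height `δ / Q` of the neighbourhood with `l ^ 2`, where `l` is the length of
  -- the intervals; it is kept between `G₀` and `M ^ 2 * G₀`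
  obtain ⟨G₀, hG₀⟩ : ∃ G₀, G₀ = max (2 * C) (16 * C / (3 * η)) := ⟨_, rfl⟩
  have hG₀C : 2 * C ≤ G₀ := hG₀ ▸ le_max_left _ _
  have hG₀η : 16 * C / (3 * η) ≤ G₀ := hG₀ ▸ le_max_right _ _
  have hG₀0 : 0 < G₀ := by linarith
  obtain ⟨θ, hθdef⟩ : ∃ θ, θ = min (1 / 8) (η / 504) := ⟨_, rfl⟩
  have hθ : 0 < θ := by rw [hθdef]; positivity
  have hθ8 : θ ≤ 1 / 8 := hθdef ▸ min_le_left _ _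
  have hθη : θ ≤ η / 504 := hθdef ▸ min_le_right _ _
  obtain ⟨M, hM2, hMK⟩ := exists_log_le_rpow (12 * C ^ 2 / c) 1 (by linarith : 0 < ε / 8)
  have hM0 : 0 < M := by omega
  have hM0' : (0 : ℝ) < M := by exact_mod_cast hM0
  obtain ⟨A₀, hA₀⟩ : ∃ A₀, A₀ = (M : ℝ) ^ 2 * G₀ := ⟨_, rfl⟩
  have hA₀0 : 0 < A₀ := by rw [hA₀]; positivity
  obtain ⟨H, hH⟩ : ∃ H, H = A₀ + C := ⟨_, rfl⟩
  obtain ⟨C₀, hC₀⟩ : ∃ C₀, C₀ = 2 * (1 + (ξ - ρ) + 1 / (ξ - ρ)) + (3 * C * M) ^ 2 := ⟨_, rfl⟩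
  have hC₀0 : 0 < C₀ := by rw [hC₀]; positivity
  obtain ⟨F, hF⟩ : ∃ F, F = 1500 * H ^ 3 / θ ^ 2 := ⟨_, rfl⟩
  have hH0 : 0 < H := by rw [hH]; positivity
  have hF0 : 0 < F := by rw [hF]; positivity
  obtain ⟨B, hB⟩ : ∃ B, B = F * C₀ * (Real.sqrt A₀ * (ξ - ρ)) ^ (ε / 8) * Real.sqrt A₀ := ⟨_, rfl⟩
  have hB0 : 0 < B := by rw [hB]; positivity
  have hev1 := (tendsto_log_mul_rpow_neg B (by linarith : 0 < 3 * ε / 8)).eventually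
    (gt_mem_nhds (by positivity : 0 < η / 4))
  have hev2 := (tendsto_rpow_atTop (by linarith : 0 < ε / 2)).eventually
    (eventually_ge_atTop (Real.sqrt A₀))
  have hev3 := ((tendsto_moebiusCubeSum.comp (tendsto_nat_floor_atTop (α := ℝ))).eventually
    (Metric.ball_mem_nhds _ (by positivity : 0 < 3 * η / 8)))
  obtain ⟨Q₁, hQ₁⟩ := eventually_atTop.1 (hev1.and (hev2.and (hev3.and
    ((eventually_ge_atTop 1).and (eventually_ge_atTop (1 / (2 * G₀ * (ξ - ρ) ^ 2)))))))
  refine ⟨max 1 Q₁, le_max_left _ _, ?_⟩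
  intro f g hfg Q δ hQ hδQ hδ2
  obtain ⟨q1, q2, q3, q4, q5⟩ := hQ₁ Q ((le_max_right _ _).trans hQ)
  have hQ0 : 0 < Q := by linarith
  have hδ : 0 < δ := lt_trans (Real.rpow_pos_of_pos hQ0 _) hδQ
  obtain ⟨n, hGl, hGu⟩ := exists_grid_level (G₀ := G₀) hV hQ0 hδ (M := M) (by omega) (by
    rw [div_le_iff₀ (by positivity)] at q5
    have : G₀ * Q * (ξ - ρ) ^ 2 = Q * (2 * G₀ * (ξ - ρ) ^ 2) / 2 := by ring
    linarith)
  obtain ⟨N, hNdef⟩ : ∃ N, N = M ^ n := ⟨_, rfl⟩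
  have hN : 0 < N := hNdef ▸ Nat.pow_pos hM0
  have hN0 : (0 : ℝ) < N := by exact_mod_cast hN
  have hNM : (N : ℝ) = (M : ℝ) ^ n := by rw [hNdef]; push_cast; rfl
  rw [← hNM] at hGl hGu
  rw [← hA₀] at hGu
  obtain ⟨G, hG⟩ : ∃ G, G = δ * N ^ 2 / (Q * (ξ - ρ) ^ 2) := ⟨_, rfl⟩
  rw [← hG] at hGl hGu
  have hG0 : 0 < G := by linarith
  have hG1 : 1 ≤ G := by linarith
  obtain ⟨r, hr⟩ : ∃ r, r = (ξ - ρ) / N * Q := ⟨_, rfl⟩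
  have hr0 : 0 < r := by rw [hr]; positivity
  have hr2 : r ^ 2 * G = δ * Q := by rw [hr, hG]; field_simp
  -- `r` is at least a small constant times `Q ^ (ε / 2)`
  have hrQ : Q ^ (ε / 2) ≤ r * Real.sqrt A₀ := by
    have h1 : Q ^ ε ≤ δ * Q := by
      have : Q ^ ε = Q ^ (ε - 1) * Q := by
        rw [← Real.rpow_add_one hQ0.ne']; congr 1; ring
      rw [this]
      gcongr
    have h2 : δ * Q ≤ r ^ 2 * A₀ := by rw [← hr2]; gcongr
    have h3 : (Q ^ (ε / 2)) ^ 2 ≤ (r * Real.sqrt A₀) ^ 2 := by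
      rw [mul_pow, Real.sq_sqrt hA₀0.le, ← Real.rpow_natCast, ← Real.rpow_mul hQ0.le]
      norm_num
      linarith
    exact le_of_sq_le_sq h3 (by positivity)
  have hsA : 0 < Real.sqrt A₀ := Real.sqrt_pos.2 hA₀0
  have hr1 : 1 ≤ r := by
    have : Real.sqrt A₀ ≤ r * Real.sqrt A₀ := q2.trans hrQ
    exact le_of_mul_le_mul_right (by linarith) hsA
  have hQε : 1 ≤ Q ^ (ε / 2) := Real.one_le_rpow q4 (by linarith)
  have hNQ : (N : ℝ) ≤ Real.sqrt A₀ * (ξ - ρ) * Q := by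
    have e : N * r = (ξ - ρ) * Q := by rw [hr]; field_simp
    have : (N : ℝ) * 1 ≤ N * (r * Real.sqrt A₀) := by gcongr; exact hQε.trans hrQ
    calc (N : ℝ) = N * 1 := (mul_one _).symm
      _ ≤ N * (r * Real.sqrt A₀) := this
      _ = Real.sqrt A₀ * (N * r) := by ring
      _ = _ := by rw [e]; ring
  have hcusp : ∑ k ∈ Finset.range N, cuspHeight f g ((ξ - ρ) / N) (ρ + k * ((ξ - ρ) / N))
      ≤ N * (C₀ * ((Real.sqrt A₀ * (ξ - ρ)) ^ (ε / 8) * Q ^ (ε / 8))) := by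
    have h1 := hfg.sum_cuspHeight_grid_le hI hc hc1 hC hM0 n
    rw [← hNdef, ← hNM] at h1
    refine h1.trans ?_
    gcongr
    rw [← hC₀]
    have hlog : 0 ≤ Real.log M := Real.log_natCast_nonneg M
    have h2 : (12 * C ^ 2 / c * (3 + 2 * Real.log M) + 1) ^ n ≤ (N : ℝ) ^ (ε / 8) := by
      rw [hNM, ← Real.rpow_pow_comm hM0'.le]
      exact pow_le_pow_left₀ (by positivity) hMK _
    have h3 : (N : ℝ) ^ (ε / 8) ≤ (Real.sqrt A₀ * (ξ - ρ)) ^ (ε / 8) * Q ^ (ε / 8) := by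
      rw [← Real.mul_rpow (by positivity) hQ0.le]
      exact Real.rpow_le_rpow hN0.le hNQ (by linarith)
    have h4 := mul_le_mul_of_nonneg_right (h2.trans h3) hC₀0.le
    have h5 : 0 ≤ (3 * C * (M : ℝ)) ^ 2 := by positivity
    linarith
  have hmain := hfg.abs_countNear_sub_le hI hC hN q4 hδ hG (hG₀C.trans hGl)
    (by rw [hH]; linarith : G + C ≤ H) hθ hθ8 (by rw [← hr]; exact hr1)
  rw [← hr, ← hF] at hmain
  obtain ⟨X, hX⟩ : ∃ X, X = (ξ - ρ) * δ * Q ^ 2 := ⟨_, rfl⟩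
  rw [← hX] at hmain ⊢
  have hX0 : 0 < X := by rw [hX]; positivity
  have hXr : X = N * (G * r ^ 3) := by rw [hX, hr, hG]; field_simp
  have hlogQ : 0 ≤ Real.log Q := Real.log_nonneg q4
  have hthird : F * (1 + Real.log Q) * r ^ 2 *
      ∑ k ∈ Finset.range N, cuspHeight f g ((ξ - ρ) / N) (ρ + k * ((ξ - ρ) / N)) ≤ η / 4 * X := by
    have h1 := mul_le_mul_of_nonneg_left hcusp
      (by positivity : 0 ≤ F * (1 + Real.log Q) * r ^ 2)
    refine h1.trans ?_
    -- the saving `Q ^ (ε / 2)` in `r` outweighs the loss `Q ^ (ε / 8)` in `hcusp`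
    have h2 : F * (1 + Real.log Q) * r ^ 2 *
        (N * (C₀ * ((Real.sqrt A₀ * (ξ - ρ)) ^ (ε / 8) * Q ^ (ε / 8))))
        = B * ((1 + Real.log Q) * Q ^ (-(3 * ε / 8))) * (N * r ^ 2 * (Q ^ (ε / 2) / Real.sqrt A₀))
        := by
      have e : Q ^ (ε / 8) = Q ^ (-(3 * ε / 8)) * Q ^ (ε / 2) := by
        rw [← Real.rpow_add hQ0]; congr 1; ring
      rw [e, hB]
      field_simp
    have h3 : Q ^ (ε / 2) / Real.sqrt A₀ ≤ G * r := by
      rw [div_le_iff₀ hsA]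
      calc Q ^ (ε / 2) ≤ 1 * (r * Real.sqrt A₀) := by rw [one_mul]; exact hrQ
        _ ≤ G * (r * Real.sqrt A₀) := by gcongr
        _ = _ := by ring
    rw [h2, hXr]
    have h4 : N * r ^ 2 * (Q ^ (ε / 2) / Real.sqrt A₀) ≤ N * (G * r ^ 3) := by
      calc N * r ^ 2 * (Q ^ (ε / 2) / Real.sqrt A₀) ≤ N * r ^ 2 * (G * r) := by gcongr
        _ = _ := by ring
    exact mul_le_mul q1.le h4 (by positivity) (by positivity)
  have hfirst : 4 * C / (3 * G) ≤ η / 4 := by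
    rw [div_le_iff₀ (by positivity)] at hG₀η
    rw [div_le_iff₀ (by positivity)]
    have := mul_le_mul_of_nonneg_right hGl (by positivity : 0 ≤ 3 * η)
    linarith
  have hsecond : 126 * θ ≤ η / 4 := by linarith
  have hfourth : |2 / 3 * X * moebiusCubeSum ⌊Q⌋₊ - 2 / (3 * zeta3) * X| ≤ η / 4 * X := by
    have e : 2 / 3 * X * moebiusCubeSum ⌊Q⌋₊ - 2 / (3 * zeta3) * X
        = 2 / 3 * X * (moebiusCubeSum ⌊Q⌋₊ - 1 / zeta3) := by
      have := zeta3_pos.ne'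
      field_simp
    rw [e, abs_mul, abs_of_nonneg (by positivity)]
    have h1 : |moebiusCubeSum ⌊Q⌋₊ - 1 / zeta3| ≤ 3 * η / 8 := by
      have : dist (moebiusCubeSum ⌊Q⌋₊) (1 / zeta3) < 3 * η / 8 := q3
      exact this.le
    calc 2 / 3 * X * |moebiusCubeSum ⌊Q⌋₊ - 1 / zeta3| ≤ 2 / 3 * X * (3 * η / 8) := by gcongr
      _ = _ := by ring
  have h12 : X * (4 * C / (3 * G) + 126 * θ) ≤ X * (η / 4 + η / 4) := by gcongr
  have htri := abs_sub_le (countNear ρ ξ f Q δ : ℝ) (2 / 3 * X * moebiusCubeSum ⌊Q⌋₊)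
    (2 / (3 * zeta3) * X)
  linarith

/-- For bounded `Q` there are boundedly many triples, uniformly in `f`: since `δ ≤ 1 / 2`, the pair
`(a, q)` determines `b`. -/
lemma exists_forall_countNear_le (ρ ξ Q₀ : ℝ) :
    ∃ B : ℕ, ∀ (f : ℝ → ℝ) (Q δ : ℝ), 1 ≤ Q → Q ≤ Q₀ → 0 < δ → δ ≤ 1 / 2 →
      countNear ρ ξ f Q δ ≤ B := by
  set K : ℤ := ⌈(|ρ| + |ξ|) * Q₀⌉ with hK
  refine ⟨(Finset.Icc (-K) K ×ˢ Finset.Icc (1 : ℤ) ⌊Q₀⌋).card, ?_⟩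
  intro f Q δ hQ hQQ hδ hδ2
  rw [countNear, ← Set.ncard_coe_finset]
  refine Set.ncard_le_ncard_of_injOn (fun p : ℤ × ℤ × ℤ => (p.1, p.2.2)) ?_ ?_
    (Finset.finite_toSet _)
  · rintro ⟨a, b, q⟩ ⟨h1, h2, h3, -, -⟩
    simp only at h1 h2 h3
    have hq : (0 : ℝ) < q := by exact_mod_cast (by omega : 0 < q)
    simp only [Finset.coe_product, Finset.coe_Icc, Set.mem_prod, Set.mem_Icc]
    have hq0 : (q : ℝ) ≤ Q₀ := h2.trans hQQ
    have h4 : |(a : ℝ) / q| ≤ |ρ| + |ξ| := by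
      rw [abs_le]
      constructor
      · linarith [h3.1, neg_abs_le ρ, abs_nonneg ξ]
      · linarith [h3.2, le_abs_self ξ, abs_nonneg ρ]
    have h5 : |(a : ℝ)| ≤ K := by
      rw [abs_div, abs_of_pos hq, div_le_iff₀ hq] at h4
      refine (h4.trans ?_).trans (Int.le_ceil _)
      gcongr
    have h6 : |a| ≤ K := by exact_mod_cast h5
    exact ⟨abs_le.1 h6, h1, Int.le_floor.2 hq0⟩
  · rintro ⟨a, b, q⟩ ⟨h1, h2, -, -, h3⟩ ⟨a', b', q'⟩ ⟨-, -, -, -, h3'⟩ heq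
    simp only [Prod.mk.injEq] at heq
    obtain ⟨rfl, rfl⟩ := heq
    simp only at h1 h2 h3 h3'
    have hq : (0 : ℝ) < q := by exact_mod_cast (by omega : 0 < q)
    have hQ0 : 0 < Q := by linarith
    have h4 : |(b : ℝ) / q - b' / q| < 2 * (δ / Q) := by
      have := abs_sub_le ((b : ℝ) / q) (f (a / q)) (b' / q)
      rw [abs_sub_comm] at h3
      linarith
    rw [← sub_div, abs_div, abs_of_pos hq, div_lt_iff₀ hq] at h4
    have h5 : 2 * (δ / Q) * q ≤ 1 := by
      have : δ / Q * q ≤ δ := by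
        rw [div_mul_eq_mul_div, div_le_iff₀ hQ0]
        gcongr
      linarith
    have h6 : |b - b'| < 1 := by exact_mod_cast h4.trans_le h5
    have h7 : b = b' := by
      rw [Int.abs_lt_one_iff] at h6
      omega
    rw [h7]

theorem theorem2 (ρ ξ c₁ c₂ ε : ℝ) (L : ℝ≥0) (hI : ρ < ξ) (hc₁ : 0 < c₁) (hc : c₁ ≤ c₂)
    (hε₀ : 0 < ε) (hε₁ : ε < 1) :
    (∀ η : ℝ, 0 < η → ∃ C : ℝ, ∀ f : ℝ → ℝ, IsCurvedArc ρ ξ c₁ c₂ L f →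
      ∀ τ : ℝ, 0 < τ → τ < ε / 2 →
      ∀ Q δ : ℝ, 1 ≤ Q → Q ^ (ε - 1) < δ → δ ≤ 1 / 2 →
        2 / (3 * zeta3) - η - C * Q ^ (-τ) ≤
            (countNear ρ ξ f Q δ : ℝ) / ((ξ - ρ) * δ * Q ^ 2) ∧
          (countNear ρ ξ f Q δ : ℝ) / ((ξ - ρ) * δ * Q ^ 2) ≤
            2 / (3 * zeta3) + η + C * Q ^ (-τ)) ∧
    (∀ f : ℝ → ℝ, IsCurvedArc ρ ξ c₁ c₂ L f →
      ∀ δ : ℝ → ℝ, (∀ᶠ Q : ℝ in atTop, Q ^ (ε - 1) < δ Q ∧ δ Q ≤ 1 / 2) →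
        (fun Q : ℝ => (countNear ρ ξ f Q (δ Q) : ℝ)) ~[atTop]
          (fun Q : ℝ => 2 / (3 * zeta3) * (ξ - ρ) * δ Q * Q ^ 2)) := by
  have hV : 0 < ξ - ρ := sub_pos.2 hI
  have hz := zeta3_pos
  have huniform := fun (η : ℝ) (hη : 0 < η) => exists_forall_abs_countNear_sub_le (C := max c₂ 1)
    hI (lt_min hc₁ one_pos) (min_le_right c₁ 1) (le_max_right _ _) hε₀ hη
  have hcurv : ∀ f, IsCurvedArc ρ ξ c₁ c₂ L f →
      CurvatureBounds ρ ξ (min c₁ 1) (max c₂ 1) f (derivWithin f (Set.Icc ρ ξ)) :=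
    fun f hf => hf.curvatureBounds hI (min_le_left _ _) (le_max_left _ _)
  constructor
  · intro η hη
    obtain ⟨Q₀, hQ₀1, hQ₀⟩ := huniform η hη
    obtain ⟨B, hB⟩ := exists_forall_countNear_le ρ ξ Q₀
    set D := B / (ξ - ρ) + 2 / (3 * zeta3) with hD
    have hD0 : 0 < D := by positivity
    refine ⟨D * Q₀ ^ (ε / 2), ?_⟩
    intro f hf τ hτ hτε Q δ hQ hδQ hδ2
    have hQ0 : 0 < Q := by linarith
    have hδ : 0 < δ := lt_trans (Real.rpow_pos_of_pos hQ0 _) hδQ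
    have hX : 0 < (ξ - ρ) * δ * Q ^ 2 := by positivity
    rcases le_total Q₀ Q with h | h
    · have h1 := hQ₀ f _ (hcurv f hf) Q δ h hδQ hδ2
      have hE : 0 ≤ D * Q₀ ^ (ε / 2) * Q ^ (-τ) := by positivity
      rw [le_div_iff₀ hX, div_le_iff₀ hX]
      have h2 := mul_nonneg hE hX.le
      obtain ⟨h3, h4⟩ := abs_le.1 h1
      constructor <;> linarith
    · -- for `Q ≤ Q₀` the error term alone exceeds both the ratio and the limit
      have hE : D ≤ D * Q₀ ^ (ε / 2) * Q ^ (-τ) := by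
        have h1 : 1 ≤ Q₀ ^ (ε / 2) * Q ^ (-τ) := by
          rw [Real.rpow_neg hQ0.le, ← div_eq_mul_inv, one_le_div (by positivity)]
          calc Q ^ τ ≤ Q ^ (ε / 2) := Real.rpow_le_rpow_of_exponent_le hQ hτε.le
            _ ≤ Q₀ ^ (ε / 2) := Real.rpow_le_rpow hQ0.le h (by linarith)
        rw [mul_assoc]
        exact le_mul_of_one_le_right hD0.le h1
      have hratio : (countNear ρ ξ f Q δ : ℝ) / ((ξ - ρ) * δ * Q ^ 2) ≤ B / (ξ - ρ) := by
        have h1 : (countNear ρ ξ f Q δ : ℝ) ≤ B := by exact_mod_cast hB f Q δ hQ h hδ hδ2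
        have h2 : 1 ≤ δ * Q ^ 2 := by
          have h3 : Q ^ (ε - 1) * Q ^ 2 = Q ^ (ε + 1) := by
            rw [← Real.rpow_natCast, ← Real.rpow_add hQ0]
            congr 1
            push_cast
            ring
          calc (1 : ℝ) ≤ Q ^ (ε + 1) := Real.one_le_rpow hQ (by linarith)
            _ = Q ^ (ε - 1) * Q ^ 2 := h3.symm
            _ ≤ δ * Q ^ 2 := by gcongr
        refine div_le_div₀ (by positivity) h1 hV ?_
        rw [mul_assoc]
        exact le_mul_of_one_le_right hV.le h2
      have hratio0 : 0 ≤ (countNear ρ ξ f Q δ : ℝ) / ((ξ - ρ) * δ * Q ^ 2) := by positivity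
      have hlim : 0 < 2 / (3 * zeta3) := by positivity
      have hBV : 0 ≤ B / (ξ - ρ) := by positivity
      constructor <;> linarith
  · intro f hf δ hδ
    rw [IsEquivalent, isLittleO_iff]
    intro a ha
    have hlim : 0 < 2 / (3 * zeta3) := by positivity
    obtain ⟨Q₀, hQ₀1, hQ₀⟩ := huniform (a * (2 / (3 * zeta3))) (by positivity)
    filter_upwards [hδ, eventually_ge_atTop Q₀] with Q hδQ hQ
    have hQ0 : 0 < Q := by linarith
    have hδ0 : 0 < δ Q := lt_trans (Real.rpow_pos_of_pos hQ0 _) hδQ.1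
    have h1 := hQ₀ f _ (hcurv f hf) Q (δ Q) hQ hδQ.1 hδQ.2
    have e : 2 / (3 * zeta3) * (ξ - ρ) * δ Q * Q ^ 2
        = 2 / (3 * zeta3) * ((ξ - ρ) * δ Q * Q ^ 2) := by ring
    simp only [Pi.sub_apply, Real.norm_eq_abs]
    rw [e, abs_of_pos (by positivity : 0 < 2 / (3 * zeta3) * ((ξ - ρ) * δ Q * Q ^ 2))]
    exact h1.trans (le_of_eq (by ring))
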